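/- Let $n\ge 2$ be an integer (the physical cases are $n=2,3$), $\kappa>0$, $\lambda>0$, and let $h:(0,\infty)\to[0,\infty)$ be a twice differentiable $C^1$ function with $h''(d)>0$ for all $d>0$, $h(d)\to\infty$ and $h'(d)\to-\infty$ as $d\to0^+$, $h(d)/d\to\infty$ and $h'(d)\to\infty$ as $d\to\infty$. Let $$\mathcal A_\lambda=\{r\in W^{1,1}(0,1): r(1)=\lambda,\ r'(R)>0\text{ for a.e. }R\in(0,1),\ r(0)\ge0\}$$ (each $r$ being identified with its continuous representative on $[0,1]$), and for $r\in\mathcal A_\lambda$ write $\delta(R)=r'(R)\,(r(R)/R)^{n-1}$ and $$\hat I(r)=\int_0^1R^{n-1}\Big[\tfrac{\kappa}{n}(r')^n+h(\delta(R))+\kappa(n-1)\,\delta(R)\Big(\tfrac1n+\ln\tfrac{r(R)}{R}\Big)\Big]dR-\tfrac{\kappa(n-1)}{n}\lambda^n\ln\lambda\ \in(-\infty,+\infty].$$ Define, for $v_1,\dots,v_n>0$, $$\hat\Phi(v_1,\dots,v_n)=\tfrac{\kappa}{n}v_1^n+h(v_1\cdots v_n)+\kappa\, v_1\cdots v_n\Big(\tfrac{n-1}{n}+\ln(v_2\cdots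 v_n)\Big),$$ write $\hat\Phi_{,i}(r(R))$ for the partial derivative $\partial\hat\Phi/\partial v_i$ evaluated at $\big(r'(R),\tfrac{r(R)}{R},\dots,\tfrac{r(R)}{R}\big)$, and define the modified radial Cauchy stress $\hat T(r(R))=\big(\tfrac{r(R)}{R}\big)^{1-n}\hat\Phi_{,1}(r(R))$. Theorem. Assume that there are constants $K>0$ and $\gamma_0\in(0,1)$ such that $$|d\,h'(cd)|\le K\,[h(d)+1]\qquad\text{for all } d>0 \text{ and all } c \text{ with } |c-1|\le\gamma_0,$$ and let $r$ be any minimizer of $\hat I$ over $\mathcal A_\lambda$. Then $r\in C^1(0,1]$, $r'(R)>0$ for all $R\in(0,1]$, the function $R\mapsto R^{n-1}\hat\Phi_{,1}(r(R))$ is $C^1$ on $(0,1]$, and $r$ satisfies the modified Euler–Lagrange equation $$\frac{d}{dR}\Big[R^{n-1}\hat\Phi_{,1}(r(R))\Big]=(n-1)R^{n-2}\,\hat\Phi_{,2}(r(R)),\qquad 0<R\le1$$ (with one-sided derivatives at $R=1$). Moreover, if $r(0)>0$, then $\lim_{R\to0^+}\hat T(r(R))=0$. -/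

import Mathlib

open Set Filter Topology MeasureTheory

noncomputable section

namespace Cavitation

/-- The conditions on the compressibility term `h : (0,∞) → [0,∞)` of the stored energy
`Φ(v₁,…,vₙ) = (κ/n) ∑ vᵢⁿ + h(v₁⋯vₙ)`. Only the values of `h` on `(0,∞)` matter. A positive
value of `deriv (deriv h) d` entails that `h` is twice differentiable at `d`. -/
structure IsCompressibilityTerm (h : ℝ → ℝ) : Prop where
  nonneg : ∀ d, 0 < d → 0 ≤ h d
  contDiffOn : ContDiffOn ℝ 1 h (Ioi 0)
  second_deriv_pos : ∀ d, 0 < d → 0 < deriv (deriv h) d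
  tendsto_zero : Tendsto h (𝓝[>] 0) atTop
  superlinear : Tendsto (fun d => h d / d) atTop atTop
  deriv_tendsto_zero : Tendsto (deriv h) (𝓝[>] 0) atBot
  deriv_tendsto_top : Tendsto (deriv h) atTop atTop

/-- `|d h'(c d)| ≤ K (h(d) + 1)` for all `d > 0` and `|c - 1| ≤ γ₀`, for some constants `K > 0`
and `γ₀ > 0`. The bound `γ₀ < 1` only ensures that `c d` lies in the domain `(0,∞)` of `h'`. -/
def DerivGrowth (h : ℝ → ℝ) : Prop :=
  ∃ K γ₀ : ℝ, 0 < K ∧ 0 < γ₀ ∧ γ₀ < 1 ∧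
    ∀ d c : ℝ, 0 < d → |c - 1| ≤ γ₀ → |d * deriv h (c * d)| ≤ K * (h d + 1)

/-- The derivative `r'` of a function on `[0,1]` (one-sided at the end points). -/
def radialDeriv (r : ℝ → ℝ) (R : ℝ) : ℝ := derivWithin r (Icc 0 1) R

/-- The set `𝒜_λ` of radial deformations: `r ∈ W^{1,1}(0,1)` (identified with its absolutely
continuous representative on `[0,1]`), `r(1) = λ`, `r' > 0` almost everywhere, `r(0) ≥ 0`. -/
def admissible (lam : ℝ) : Set (ℝ → ℝ) :=
  {r | AbsolutelyContinuousOnInterval r 0 1 ∧ r 1 = lam ∧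
    (∀ᵐ R ∂(volume.restrict (Ioo (0 : ℝ) 1)), 0 < radialDeriv r R) ∧ 0 ≤ r 0}

/-- The determinant `δ(R) = r'(R) (r(R)/R)^(n-1)`. -/
def det (n : ℕ) (r : ℝ → ℝ) (R : ℝ) : ℝ := radialDeriv r R * (r R / R) ^ (n - 1)

/-- The integrand of the modified energy functional:
`R^(n-1) [ (κ/n) r'^n + h(δ) + κ (n-1) δ (1/n + log (r/R)) ]`. -/
def energyDensity (n : ℕ) (κ : ℝ) (h r : ℝ → ℝ) (R : ℝ) : ℝ :=
  R ^ (n - 1) * (κ / n * radialDeriv r R ^ n + h (det n r R)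
    + κ * (n - 1) * det n r R * (1 / n + Real.log (r R / R)))

open Classical in
/-- The modified energy functional `Î`, with values in `(-∞, +∞]`:
`Î(r) = ∫₀¹ (energy density) dR - (κ (n-1)/n) λⁿ log λ`, for `r ∈ 𝒜_λ`.
For such `r` the density is measurable with integrable negative part (as `h ≥ 0` and
`R^(n-1) δ log (r/R) ≥ r^(n-1) log r * r'` on `(0,1)`), so the Lebesgue integral always exists, and
it equals `+∞` exactly when the density is not integrable. -/
def modifiedEnergy (n : ℕ) (κ : ℝ) (h : ℝ → ℝ) (lam : ℝ) (r : ℝ → ℝ) : EReal :=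
  if IntegrableOn (energyDensity n κ h r) (Ioo 0 1) then
    (((∫ R in Ioo (0 : ℝ) 1, energyDensity n κ h r R)
      - κ * (n - 1) / n * lam ^ n * Real.log lam : ℝ) : EReal)
  else ⊤

/-- The modified stored energy function (the stretch `v₁` has index `0`)
`Φ̂(v₁,…,vₙ) = (κ/n) v₁ⁿ + h(v₁⋯vₙ) + κ v₁⋯vₙ ((n-1)/n + log (v₂⋯vₙ))`. -/
def hatPhi (n : ℕ) [NeZero n] (κ : ℝ) (h : ℝ → ℝ) (v : Fin n → ℝ) : ℝ :=
  κ / n * v 0 ^ n + h (∏ i, v i)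
    + κ * (∏ i, v i) * ((n - 1) / n + Real.log (∏ i ∈ Finset.univ.erase 0, v i))

/-- The principal stretches `(r'(R), r(R)/R, …, r(R)/R)` of a radial deformation. -/
def stretches (n : ℕ) [NeZero n] (r : ℝ → ℝ) (R : ℝ) : Fin n → ℝ :=
  Function.update (fun _ => r R / R) 0 (radialDeriv r R)

/-- The partial derivative of `Φ̂` in its variable of index `i`, evaluated at
`(r'(R), r(R)/R, …, r(R)/R)`. The index `0` gives `Φ̂_{,1}(r(R))`, the index `1` `Φ̂_{,2}(r(R))`. -/
def hatPhiPartial (n : ℕ) [NeZero n] (κ : ℝ) (h : ℝ → ℝ) (i : Fin n) (r : ℝ → ℝ) (R : ℝ) : ℝ :=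
  lineDeriv ℝ (hatPhi n κ h) (stretches n r R) (Pi.single i 1)

/-- The modified radial Cauchy stress `T̂(r(R)) = (r(R)/R)^(1-n) Φ̂_{,1}(r(R))`. -/
def modifiedStress (n : ℕ) [NeZero n] (κ : ℝ) (h r : ℝ → ℝ) (R : ℝ) : ℝ :=
  hatPhiPartial n κ h 0 r R / (r R / R) ^ (n - 1)

end Cavitation

end

namespace Cavitation

/-! Write w = rⁿ and p = rⁿ⁻¹r', so that w' = np and δ = p/Rⁿ⁻¹. In these variables the energy
density is a Lagrangian L(R,w,p) in which h sees p but not w. Moving w by ntψ with ψ' = v moves p by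
tv, so the h-term is disturbed only where v ≠ 0. If v is bounded and lives where R is bounded below
and p is bounded above and away from zero, all terms there are bounded by compactness. Elsewhere
only ψ·n∂L/∂w remains; it is controlled by p and Rⁿ⁻¹r'ⁿ, both integrable because a minimizer has
finite energy. Hence differentiation under the integral is legitimate
(`IsTest.exists_integrable_bound`, `IsTest.first_variation`).

Let T = ∂L/∂p and Q = n∂L/∂w along r, and let G be the primitive of Q with G(1) = 0. Integration by
parts turns the vanishing first variation into orthogonality of v to T − G, up to a boundary term
(`IsTest.integral_mul_stress`). A du Bois-Reymond argument on increasing sets that exhaust (0,1) up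
to a null set gives T = G + c a.e. (`IsMinimizer.exists_stress_eq`). If r(0) > 0, then ψ(0) is free
and the boundary term forces c = −G(0), the natural boundary condition.

Since h' increases strictly from −∞ to ∞, ∂L/∂p is a strictly increasing bijection in p > 0. So r'
agrees a.e. with a continuous positive function obtained by solving ∂L/∂p = G + c, and r is C¹
(`IsMinimizer.regularity`). Then Q is continuous and T' = Q. As Rⁿ⁻¹Φ̂,₁ = rⁿ⁻¹T, the product rule
is the Euler–Lagrange equation; as T̂ = T, the value c + G(0) = 0 is the limit of the stress. -/

variable {n : ℕ} {κ lam : ℝ} {h r : ℝ → ℝ}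

/-! ### Elementary properties of admissible deformations -/

theorem radialDeriv_eq_deriv {R : ℝ} (hR : R ∈ Ioo (0 : ℝ) 1) : radialDeriv r R = deriv r R :=
  derivWithin_of_mem_nhds (Icc_mem_nhds hR.1 hR.2)

theorem ae_deriv_pos (hr : r ∈ admissible lam) :
    ∀ᵐ R ∂(volume.restrict (Ioo (0 : ℝ) 1)), 0 < deriv r R := by
  filter_upwards [hr.2.2.1, ae_restrict_mem measurableSet_Ioo] with R h1 h2
  rwa [radialDeriv_eq_deriv h2] at h1

theorem continuousOn_of_admissible (hr : r ∈ admissible lam) : ContinuousOn r (Icc 0 1) := by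
  simpa [uIcc_of_le] using hr.1.continuousOn

theorem strictMonoOn_of_admissible (hr : r ∈ admissible lam) : StrictMonoOn r (Icc 0 1) := by
  intro x hx y hy hxy
  have hac : AbsolutelyContinuousOnInterval r x y :=
    hr.1.mono (by rw [uIcc_of_le hxy.le, uIcc_of_le zero_le_one]; exact Icc_subset_Icc hx.1 hy.2)
  have hpos : ∀ᵐ R ∂(volume.restrict (Ioc x y)), 0 < deriv r R := by
    rw [← restrict_Ioo_eq_restrict_Ioc]
    exact ae_mono (Measure.restrict_mono (Ioo_subset_Ioo hx.1 hy.2) le_rfl) (ae_deriv_pos hr)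
  rw [← sub_pos, ← hac.integral_deriv_eq_sub, intervalIntegral.integral_of_le hxy.le,
    integral_pos_iff_support_of_nonneg_ae (hpos.mono fun _ h => h.le)
      (hac.intervalIntegrable_deriv.1)]
  have hsupp : (volume.restrict (Ioc x y)) (Function.support (deriv r))ᶜ = 0 := by
    refine measure_mono_null ?_ (ae_iff.1 hpos)
    intro R hR
    simp only [mem_compl_iff, Function.mem_support, not_not] at hR
    simp [hR]
  have huniv : (volume.restrict (Ioc x y)) univ ≠ 0 := by simp [hxy]
  rw [pos_iff_ne_zero]
  intro h0
  apply huniv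
  rw [← union_compl_self (Function.support (deriv r))]
  exact measure_union_null h0 hsupp

theorem pos_of_admissible (hr : r ∈ admissible lam) {R : ℝ} (hR : R ∈ Ioc (0 : ℝ) 1) : 0 < r R :=
  hr.2.2.2.trans_lt (strictMonoOn_of_admissible hr ⟨le_rfl, zero_le_one⟩ ⟨hR.1.le, hR.2⟩ hR.1)

theorem nonneg_of_admissible (hr : r ∈ admissible lam) {R : ℝ} (hR : R ∈ Icc (0 : ℝ) 1) :
    0 ≤ r R :=
  hr.2.2.2.trans ((strictMonoOn_of_admissible hr).monotoneOn ⟨le_rfl, zero_le_one⟩ hR hR.1)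

theorem ae_hasDerivAt_of_admissible (hr : r ∈ admissible lam) :
    ∀ᵐ R ∂(volume.restrict (Ioo (0 : ℝ) 1)), HasDerivAt r (deriv r R) R := by
  rw [ae_restrict_iff' measurableSet_Ioo]
  filter_upwards [hr.1.ae_differentiableAt] with R h1 h2
  exact (h1 (by rw [uIcc_of_le zero_le_one]; exact Ioo_subset_Icc_self h2)).hasDerivAt

/-! ### The Lagrangian in the variables rⁿ and rⁿ⁻¹r' -/

/-- The energy density in terms of `w = rⁿ` and `p = rⁿ⁻¹ r'`. -/
noncomputable def lagrangian (n : ℕ) (κ : ℝ) (h : ℝ → ℝ) (R w p : ℝ) : ℝ :=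
  κ / n * R ^ (n - 1) * (p ^ n / w ^ (n - 1)) + R ^ (n - 1) * h (p / R ^ (n - 1))
    + κ * (n - 1) * p * (1 / n + Real.log w / n - Real.log R)

/-- The derivative of the Lagrangian in `p`: the modified radial Cauchy stress. -/
noncomputable def lagrangianP (n : ℕ) (κ : ℝ) (h : ℝ → ℝ) (R w p : ℝ) : ℝ :=
  κ * R ^ (n - 1) * (p ^ (n - 1) / w ^ (n - 1)) + deriv h (p / R ^ (n - 1))
    + κ * (n - 1) * (1 / n + Real.log w / n - Real.log R)

/-- `n` times the derivative of the Lagrangian in `w`. -/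
noncomputable def lagrangianW (n : ℕ) (κ : ℝ) (R w p : ℝ) : ℝ :=
  κ * (n - 1) * (p / w - R ^ (n - 1) * (p ^ n / w ^ n))

theorem energyDensity_eq_lagrangian (hn : 2 ≤ n) {R : ℝ} (hR : 0 < R) (hrR : 0 < r R) :
    energyDensity n κ h r R =
      lagrangian n κ h R (r R ^ n) (r R ^ (n - 1) * radialDeriv r R) := by
  have hn0 : (n : ℝ) ≠ 0 := by positivity
  have hd : det n r R = r R ^ (n - 1) * radialDeriv r R / R ^ (n - 1) := by
    rw [det, div_pow]; ring
  have h1 : (r R ^ (n - 1) * radialDeriv r R) ^ n / (r R ^ n) ^ (n - 1) = radialDeriv r R ^ n := by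
    rw [mul_pow, ← pow_mul, ← pow_mul, mul_comm (n - 1) n]
    field_simp
  have h2 : Real.log (r R ^ n) / n = Real.log (r R) := by
    rw [Real.log_pow]; field_simp
  rw [energyDensity, lagrangian, h1, h2, hd, Real.log_div hrR.ne' hR.ne']
  field_simp
  ring

/-- The h-term contributes only to the factor of v. The factor n in `lagrangianW` is the speed nψ at
which w moves. -/
theorem hasDerivAt_lagrangian (hn : 2 ≤ n) (hh : ∀ d, 0 < d → DifferentiableAt ℝ h d)
    {R w p ψ v t : ℝ} (hR : 0 < R) (hw : 0 < w + n * t * ψ) (hp : 0 < p + t * v) :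
    HasDerivAt (fun s => lagrangian n κ h R (w + n * s * ψ) (p + s * v))
      (v * lagrangianP n κ h R (w + n * t * ψ) (p + t * v)
        + ψ * lagrangianW n κ R (w + n * t * ψ) (p + t * v)) t := by
  obtain ⟨m, rfl⟩ : ∃ m, n = m + 2 := ⟨n - 2, by omega⟩
  have hW : HasDerivAt (fun s => w + (m + 2 : ℕ) * s * ψ) ((m + 2 : ℕ) * ψ) t := by
    have := (((hasDerivAt_id t).const_mul ((m + 2 : ℕ) : ℝ)).mul_const ψ).const_add w
    simpa using this
  have hP : HasDerivAt (fun s => p + s * v) v t := by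
    simpa using ((hasDerivAt_id t).mul_const v).const_add p
  have hH : HasDerivAt (fun s => h ((p + s * v) / R ^ (m + 1)))
      (deriv h ((p + t * v) / R ^ (m + 1)) * (v / R ^ (m + 1))) t :=
    ((hh _ (by positivity)).hasDerivAt).comp t (hP.div_const _)
  have h1 := (hP.pow (m + 2)).div (hW.pow (m + 1)) (pow_pos hw (m + 1)).ne'
  have h2 := ((hW.log hw.ne').div_const ((m + 2 : ℕ) : ℝ)).const_add (1 / ((m + 2 : ℕ) : ℝ))
  have h3 := ((h1.const_mul (κ / (m + 2 : ℕ) * R ^ (m + 1))).add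
    (hH.const_mul (R ^ (m + 1)))).add
    ((hP.const_mul (κ * ((m + 2 : ℕ) - 1))).mul (h2.sub_const (Real.log R)))
  convert! h3 using 1
  simp only [lagrangianP, lagrangianW, Nat.add_sub_cancel, Pi.pow_apply, show m + 2 - 1 = m + 1 from rfl]
  generalize w + (m + 2 : ℕ) * t * ψ = W at *
  generalize p + t * v = P at *
  push_cast
  field_simp
  ring

/-! ### Tools for absolute continuity -/

open AbsolutelyContinuousOnInterval in
-- Three controlling functions are needed for the trial deformations: r to the left of a, rⁿ + ntψ
-- to the right of it, and rⁿ for increments that straddle a.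
theorem _root_.AbsolutelyContinuousOnInterval.of_dist_le {f₁ f₂ f₃ F : ℝ → ℝ} {a b A B C : ℝ}
    (h₁ : AbsolutelyContinuousOnInterval f₁ a b) (h₂ : AbsolutelyContinuousOnInterval f₂ a b)
    (h₃ : AbsolutelyContinuousOnInterval f₃ a b)
    (hF : ∀ x ∈ uIcc a b, ∀ y ∈ uIcc a b,
      dist (F x) (F y) ≤ A * dist (f₁ x) (f₁ y) + B * dist (f₂ x) (f₂ y) + C * dist (f₃ x) (f₃ y)) :
    AbsolutelyContinuousOnInterval F a b := by
  have hsum := ((Filter.Tendsto.const_mul A h₁).add (Filter.Tendsto.const_mul B h₂)).add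
    (Filter.Tendsto.const_mul C h₃)
  simp only [mul_zero, add_zero] at hsum
  refine squeeze_zero' (Eventually.of_forall fun E => Finset.sum_nonneg fun i _ => dist_nonneg) ?_
    hsum
  filter_upwards [mem_inf_of_right (mem_principal_self _)] with E hE
  rw [Finset.mul_sum, Finset.mul_sum, Finset.mul_sum, ← Finset.sum_add_distrib,
    ← Finset.sum_add_distrib]
  exact Finset.sum_le_sum fun i hi => hF _ (hE.1 i hi).1 _ (hE.1 i hi).2

theorem _root_.AbsolutelyContinuousOnInterval.pow {f : ℝ → ℝ} {a b : ℝ}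
    (hf : AbsolutelyContinuousOnInterval f a b) (n : ℕ) :
    AbsolutelyContinuousOnInterval (fun x => f x ^ n) a b := by
  induction n with
  | zero =>
    simpa using (LipschitzWith.const (1 : ℝ)).lipschitzOnWith.absolutelyContinuousOnInterval
      (a := a) (b := b)
  | succ k ih => simpa [pow_succ] using! ih.mul hf

/-- The n-th root is Lipschitz away from zero. -/
theorem abs_sub_le_of_le_pow (hn : n ≠ 0) {c x y : ℝ} (hc : 0 < c) (hx : c ≤ x) (hy : c ≤ y) :
    |x - y| ≤ (c ^ (n - 1))⁻¹ * |x ^ n - y ^ n| := by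
  wlog hxy : y ≤ x generalizing x y
  · rw [abs_sub_comm x y, abs_sub_comm (x ^ n)]
    exact this hy hx (le_of_not_ge hxy)
  obtain ⟨m, rfl⟩ := Nat.exists_eq_succ_of_ne_zero hn
  have hy0 := hc.le.trans hy
  have hx0 := hc.le.trans hx
  have h1 : y ^ m ≤ x ^ m := pow_le_pow_left₀ hy0 hxy m
  have h2 : c ^ m ≤ x ^ m := pow_le_pow_left₀ hc.le hx m
  rw [abs_of_nonneg (sub_nonneg.2 hxy),
    abs_of_nonneg (sub_nonneg.2 (pow_le_pow_left₀ hy0 hxy _)), inv_mul_eq_div, Nat.succ_sub_one,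
    le_div_iff₀ (by positivity), pow_succ, pow_succ]
  nlinarith [mul_le_mul_of_nonneg_left h2 (sub_nonneg.2 hxy), mul_le_mul_of_nonneg_left h1 hy0]

/-! ### Test variations and trial deformations -/

/-- A bounded perturbation `v` of `rⁿ⁻¹ r'`, supported where this quantity is bounded above and
away from zero, such that its primitive vanishing at `1` also vanishes on `[0,a]`. -/
structure IsTest (n : ℕ) (r v : ℝ → ℝ) (a b M m L : ℝ) : Prop where
  aemeasurable : AEMeasurable v
  bound : ∀ R, |v R| ≤ M
  nonneg_a : 0 ≤ a
  lt_one : a < 1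
  pos_a : 0 < r a
  pos_b : 0 < b
  pos_m : 0 < m
  primitive : a = 0 ∨ ∀ R ∈ Icc 0 a, ∫ x in (1 : ℝ)..R, v x = 0
  support : ∀ R, v R ≠ 0 → R ∈ Ioo (0 : ℝ) 1 ∧ a ≤ R ∧ b ≤ R ∧ m ≤ r R ^ (n - 1) * deriv r R ∧
    r R ^ (n - 1) * deriv r R ≤ L

/-- The primitive vanishing at `1`. -/
noncomputable def prim (v : ℝ → ℝ) (R : ℝ) : ℝ := ∫ x in (1 : ℝ)..R, v x

/-- The trial deformation whose `n`-th power is `rⁿ + n t ψ`. -/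
noncomputable def trial (n : ℕ) (r ψ : ℝ → ℝ) (t R : ℝ) : ℝ :=
  (r R ^ n + n * t * ψ R) ^ ((n : ℝ)⁻¹)

section Test

variable {v : ℝ → ℝ} {a b M m L t R : ℝ}

theorem IsTest.intervalIntegrable (H : IsTest n r v a b M m L) (x y : ℝ) :
    IntervalIntegrable v volume x y :=
  (intervalIntegrable_const (c := M)).mono_fun H.aemeasurable.aestronglyMeasurable.restrict
    (Eventually.of_forall fun R => by
      simpa using (H.bound R).trans (le_abs_self M))

theorem IsTest.nonneg_M (H : IsTest n r v a b M m L) : 0 ≤ M := (abs_nonneg _).trans (H.bound 0)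

theorem IsTest.abs_prim_le (H : IsTest n r v a b M m L) (hR : R ∈ Icc (0 : ℝ) 1) :
    |prim v R| ≤ M := by
  have := intervalIntegral.norm_integral_le_of_norm_le_const (a := 1) (b := R) (f := v) (C := M)
    (fun x _ => H.bound x)
  refine this.trans ?_
  have h1 : |R - 1| ≤ 1 := by rw [abs_le]; constructor <;> linarith [hR.1, hR.2]
  nlinarith [H.nonneg_M]

theorem IsTest.prim_absolutelyContinuous (H : IsTest n r v a b M m L) :
    AbsolutelyContinuousOnInterval (prim v) 0 1 :=
  (H.intervalIntegrable 0 1).absolutelyContinuousOnInterval_intervalIntegral (by simp)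

theorem IsTest.ae_hasDerivAt_prim (H : IsTest n r v a b M m L) :
    ∀ᵐ R ∂(volume.restrict (Ioo (0 : ℝ) 1)), HasDerivAt (prim v) (v R) R := by
  rw [ae_restrict_iff' measurableSet_Ioo]
  filter_upwards [(H.intervalIntegrable 0 1).ae_hasDerivAt_integral] with R h1 h2
  exact h1 (by rw [uIcc_of_le zero_le_one]; exact Ioo_subset_Icc_self h2) 1 (by simp)

/-- The admissible size of the parameter `t`. -/
def IsSmall (n : ℕ) (r : ℝ → ℝ) (a M m t : ℝ) : Prop :=
  n * |t| * M ≤ r a ^ n / 2 ∧ |t| * M ≤ m / 2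

theorem IsTest.eventually_isSmall (H : IsTest n r v a b M m L) :
    ∃ ε > 0, ∀ t ∈ Ioo (-ε) ε, IsSmall n r a M m t := by
  have h1 : Tendsto (fun t : ℝ => n * |t| * M) (𝓝 0) (𝓝 0) := by
    have : Continuous (fun t : ℝ => n * |t| * M) := by fun_prop
    simpa using this.tendsto 0
  have h2 : Tendsto (fun t : ℝ => |t| * M) (𝓝 0) (𝓝 0) := by
    have : Continuous (fun t : ℝ => |t| * M) := by fun_prop
    simpa using this.tendsto 0
  have h3 : ∀ᶠ t in 𝓝 0, IsSmall n r a M m t :=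
    (h1.eventually_le_const (half_pos (pow_pos H.pos_a n))).and
      (h2.eventually_le_const (half_pos H.pos_m))
  obtain ⟨ε, hε, hs⟩ := Metric.eventually_nhds_iff_ball.1 h3
  refine ⟨ε, hε, fun t ht => hs t ?_⟩
  rw [Real.ball_eq_Ioo]
  simpa using ht

theorem IsTest.prim_eq_zero (H : IsTest n r v a b M m L) (hR : R ∈ Icc 0 a) (ha : a ≠ 0) :
    prim v R = 0 := (H.primitive.resolve_left ha) R hR

theorem IsTest.le_of_prim_ne_zero (H : IsTest n r v a b M m L) (hR : R ∈ Icc (0 : ℝ) 1)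
    (h0 : prim v R ≠ 0) : a ≤ R := by
  by_contra hlt
  push Not at hlt
  exact h0 (H.prim_eq_zero ⟨hR.1, hlt.le⟩ (by intro h; linarith [hR.1]))

/-- Where ψ ≠ 0 one has R ≥ a, so the smallness of t relative to r(a)ⁿ is also smallness relative to
r(R)ⁿ. A bound proportional to r(R)ⁿ, and not only a constant one, is what the domination of the
derivative requires. -/
theorem IsTest.half_pow_le (H : IsTest n r v a b M m L) (hr : r ∈ admissible lam)
    (ht : IsSmall n r a M m t) (hR : R ∈ Icc (0 : ℝ) 1) :
    r R ^ n / 2 ≤ r R ^ n + n * t * prim v R := by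
  have hr0 : 0 ≤ r R ^ n := pow_nonneg (nonneg_of_admissible hr hR) n
  by_cases h0 : prim v R = 0
  · rw [h0]; linarith
  have haR := H.le_of_prim_ne_zero hR h0
  have h1 : r a ^ n ≤ r R ^ n := pow_le_pow_left₀ H.pos_a.le
    ((strictMonoOn_of_admissible hr).monotoneOn ⟨H.nonneg_a, H.lt_one.le⟩ hR haR) n
  have h2 : |n * t * prim v R| ≤ n * |t| * M := by
    rw [abs_mul, abs_mul, Nat.abs_cast]
    exact mul_le_mul_of_nonneg_left (H.abs_prim_le hR) (by positivity)
  linarith [neg_abs_le (n * t * prim v R), ht.1]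

theorem IsTest.half_pow_a_le (H : IsTest n r v a b M m L) (hr : r ∈ admissible lam)
    (ht : IsSmall n r a M m t) (hR : R ∈ Icc (0 : ℝ) 1) (haR : a ≤ R) :
    r a ^ n / 2 ≤ r R ^ n + n * t * prim v R := by
  have h1 : r a ^ n ≤ r R ^ n := pow_le_pow_left₀ H.pos_a.le
    ((strictMonoOn_of_admissible hr).monotoneOn ⟨H.nonneg_a, H.lt_one.le⟩ hR haR) n
  linarith [H.half_pow_le hr ht hR]

theorem IsTest.pos_w (H : IsTest n r v a b M m L) (hr : r ∈ admissible lam)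
    (ht : IsSmall n r a M m t) (hR : R ∈ Ioc (0 : ℝ) 1) : 0 < r R ^ n + n * t * prim v R :=
  (half_pos (pow_pos (pos_of_admissible hr hR) n)).trans_le
    (H.half_pow_le hr ht ⟨hR.1.le, hR.2⟩)

theorem IsTest.half_m_le (H : IsTest n r v a b M m L) (ht : IsSmall n r a M m t)
    (h0 : v R ≠ 0) : m / 2 ≤ r R ^ (n - 1) * deriv r R + t * v R := by
  have h1 := (H.support R h0).2.2.2.1
  have h2 : |t * v R| ≤ |t| * M := by
    rw [abs_mul]; exact mul_le_mul_of_nonneg_left (H.bound R) (abs_nonneg t)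
  linarith [neg_abs_le (t * v R), ht.2]

theorem IsTest.pos_p (H : IsTest n r v a b M m L) (hr : r ∈ admissible lam)
    (ht : IsSmall n r a M m t) (hR : R ∈ Ioo (0 : ℝ) 1) (hd : 0 < deriv r R) :
    0 < r R ^ (n - 1) * deriv r R + t * v R := by
  by_cases h0 : v R = 0
  · rw [h0, mul_zero, add_zero]
    exact mul_pos (pow_pos (pos_of_admissible hr ⟨hR.1, hR.2.le⟩) _) hd
  · exact (half_pos H.pos_m).trans_le (H.half_m_le ht h0)

theorem trial_pow (hn : 2 ≤ n) {ψ : ℝ → ℝ} (h0 : 0 ≤ r R ^ n + n * t * ψ R) :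
    trial n r ψ t R ^ n = r R ^ n + n * t * ψ R :=
  Real.rpow_inv_natCast_pow h0 (by omega)

theorem hasDerivAt_trial (hn : 2 ≤ n) {ψ : ℝ → ℝ} {dr dψ : ℝ} (hr : HasDerivAt r dr R)
    (hψ : HasDerivAt ψ dψ R) (h0 : 0 < r R ^ n + n * t * ψ R) :
    ∃ d, HasDerivAt (trial n r ψ t) d R ∧
      trial n r ψ t R ^ (n - 1) * d = r R ^ (n - 1) * dr + t * dψ := by
  have hn0 : (n : ℝ) ≠ 0 := by positivity
  have hw := (hr.pow n).add (hψ.const_mul (n * t))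
  have hd : HasDerivAt (trial n r ψ t) _ R := hw.rpow_const (p := (n : ℝ)⁻¹) (Or.inl h0.ne')
  refine ⟨_, hd, ?_⟩
  have h1 := hd.pow n
  -- Differentiating the identity trialⁿ = rⁿ + ntψ and cancelling n replaces any manipulation of
  -- the real power.
  have hev : (trial n r ψ t) ^ n =ᶠ[𝓝 R] (r ^ n + fun y => n * t * ψ y) := by
    filter_upwards [hw.continuousAt.eventually (lt_mem_nhds h0)] with x hx
    exact trial_pow hn (le_of_lt hx)
  have h2 := (h1.congr_of_eventuallyEq hev.symm).unique hw
  have h3 : (n : ℝ) * _ = n * (r R ^ (n - 1) * dr + t * dψ) := (mul_assoc _ _ _).symm.trans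
    (h2.trans (by ring))
  exact mul_left_cancel₀ hn0 h3

/-- The root is not Lipschitz at zero, and r(0) = 0 is possible. But when a > 0 the trial coincides
with r on [0,a], while on [a,1] its n-th power stays above r(a)ⁿ/2. -/
theorem IsTest.trial_absolutelyContinuous (hn : 2 ≤ n) (H : IsTest n r v a b M m L)
    (hr : r ∈ admissible lam) (ht : IsSmall n r a M m t) :
    AbsolutelyContinuousOnInterval (trial n r (prim v) t) 0 1 := by
  have hn0 : n ≠ 0 := by omega
  have hU : AbsolutelyContinuousOnInterval (fun R => r R ^ n + n * t * prim v R) 0 1 :=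
    (hr.1.pow n).add (H.prim_absolutelyContinuous.const_mul (n * t))
  set c := (r a ^ n / 2) ^ ((n : ℝ)⁻¹) with hc
  have ha2 : 0 < r a ^ n / 2 := half_pos (pow_pos H.pos_a n)
  have hc0 : 0 < c := Real.rpow_pos_of_pos ha2 _
  set C := (c ^ (n - 1))⁻¹ with hC
  have hC0 : 0 ≤ C := by positivity
  have hmono := (strictMonoOn_of_admissible hr).monotoneOn
  have hpw : ∀ x ∈ Icc (0 : ℝ) 1, trial n r (prim v) t x ^ n = r x ^ n + n * t * prim v x := by
    intro x hx
    exact trial_pow hn (le_trans (by have := nonneg_of_admissible hr hx; positivity)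
      (H.half_pow_le hr ht hx))
  have hright : ∀ x ∈ Icc a 1, ∀ y ∈ Icc a 1, |trial n r (prim v) t x - trial n r (prim v) t y|
      ≤ C * |(r x ^ n + n * t * prim v x) - (r y ^ n + n * t * prim v y)| := by
    intro x hx y hy
    have hx' : x ∈ Icc (0 : ℝ) 1 := ⟨H.nonneg_a.trans hx.1, hx.2⟩
    have hy' : y ∈ Icc (0 : ℝ) 1 := ⟨H.nonneg_a.trans hy.1, hy.2⟩
    rw [← hpw x hx', ← hpw y hy']
    exact abs_sub_le_of_le_pow hn0 hc0
      (Real.rpow_le_rpow ha2.le (H.half_pow_a_le hr ht hx' hx.1) (by positivity))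
      (Real.rpow_le_rpow ha2.le (H.half_pow_a_le hr ht hy' hy.1) (by positivity))
  have hleft : ∀ x ∈ Icc 0 a, a ≠ 0 → trial n r (prim v) t x = r x := by
    intro x hx ha
    rw [trial, H.prim_eq_zero hx ha, mul_zero, add_zero]
    exact Real.pow_rpow_inv_natCast (nonneg_of_admissible hr ⟨hx.1, hx.2.trans H.lt_one.le⟩) hn0
  refine AbsolutelyContinuousOnInterval.of_dist_le (A := 1) (B := C) (C := C) hr.1 (hr.1.pow n) hU ?_
  rw [uIcc_of_le zero_le_one]
  simp only [Real.dist_eq]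
  intro x hx y hy
  wlog hxy : x ≤ y generalizing x y
  · have := this y hy x hx (le_of_not_ge hxy)
    rwa [abs_sub_comm, abs_sub_comm (r x), abs_sub_comm (r x ^ n),
      abs_sub_comm (r x ^ n + n * t * prim v x)]
  have p1 : 0 ≤ |r x - r y| := abs_nonneg _
  have p2 : 0 ≤ C * |r x ^ n - r y ^ n| := mul_nonneg hC0 (abs_nonneg _)
  have p3 : 0 ≤ C * |(r x ^ n + n * t * prim v x) - (r y ^ n + n * t * prim v y)| :=
    mul_nonneg hC0 (abs_nonneg _)
  rcases le_or_gt a x with hax | hax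
  · linarith [hright x ⟨hax, hx.2⟩ y ⟨hax.trans hxy, hy.2⟩]
  have ha0 : a ≠ 0 := by intro h; linarith [hx.1]
  rcases le_or_gt a y with hay | hay
  · have e1 := hright a ⟨le_rfl, H.lt_one.le⟩ y ⟨hay, hy.2⟩
    have e2 := hleft x ⟨hx.1, hax.le⟩ ha0
    have e3 := hleft a ⟨H.nonneg_a, le_rfl⟩ ha0
    have haI : a ∈ Icc (0 : ℝ) 1 := ⟨H.nonneg_a, H.lt_one.le⟩
    have m1 := hmono hx haI hax.le
    have m2 := hmono haI hy hay
    have rx0 := nonneg_of_admissible hr hx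
    have q1 : r x ^ n ≤ r a ^ n := pow_le_pow_left₀ rx0 m1 n
    have q2 : r a ^ n ≤ r y ^ n := pow_le_pow_left₀ H.pos_a.le m2 n
    have e4 : |trial n r (prim v) t x - trial n r (prim v) t a| ≤ |r x - r y| := by
      rw [e2, e3, abs_sub_comm, abs_sub_comm (r x), abs_of_nonneg (by linarith),
        abs_of_nonneg (by linarith)]
      linarith
    have z1 := H.prim_eq_zero (R := x) ⟨hx.1, hax.le⟩ ha0
    have z2 := H.prim_eq_zero (R := a) ⟨H.nonneg_a, le_rfl⟩ ha0
    -- Passing through x: ψ vanishes at both x and a, so the extra increment is r(a)ⁿ − r(x)ⁿ, which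
    -- monotonicity bounds by r(y)ⁿ − r(x)ⁿ.
    have e5 : |(r a ^ n + n * t * prim v a) - (r y ^ n + n * t * prim v y)| ≤
        |r x ^ n - r y ^ n| +
          |(r x ^ n + n * t * prim v x) - (r y ^ n + n * t * prim v y)| := by
      refine (abs_sub_le _ (r x ^ n + n * t * prim v x) _).trans (add_le_add_left ?_ _)
      rw [z1, z2, mul_zero, add_zero, add_zero, abs_sub_comm (r x ^ n),
        abs_of_nonneg (by linarith), abs_of_nonneg (by linarith)]
      linarith
    have e6 := abs_sub_le (trial n r (prim v) t x) (trial n r (prim v) t a) (trial n r (prim v) t y)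
    have e7 := mul_le_mul_of_nonneg_left e5 hC0
    linarith
  · rw [hleft x ⟨hx.1, hax.le⟩ ha0, hleft y ⟨hy.1, hay.le⟩ ha0]
    linarith

theorem IsTest.ae_trial (hn : 2 ≤ n) (H : IsTest n r v a b M m L)
    (hr : r ∈ admissible lam) (ht : IsSmall n r a M m t) :
    ∀ᵐ R ∂(volume.restrict (Ioo (0 : ℝ) 1)), 0 < radialDeriv (trial n r (prim v) t) R ∧
      energyDensity n κ h (trial n r (prim v) t) R =
        lagrangian n κ h R (r R ^ n + n * t * prim v R)
          (r R ^ (n - 1) * deriv r R + t * v R) := by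
  filter_upwards [ae_restrict_mem measurableSet_Ioo, ae_hasDerivAt_of_admissible hr,
    ae_deriv_pos hr, H.ae_hasDerivAt_prim] with R hR h1 h2 h3
  have hw := H.pos_w hr ht (R := R) ⟨hR.1, hR.2.le⟩
  have htr : 0 < trial n r (prim v) t R := Real.rpow_pos_of_pos hw _
  obtain ⟨d, hd, hde⟩ := hasDerivAt_trial hn h1 h3 hw
  have hd' : radialDeriv (trial n r (prim v) t) R = d := by
    rw [radialDeriv_eq_deriv hR, hd.deriv]
  constructor
  · rw [hd']
    have := H.pos_p hr ht hR h2
    rw [← hde] at this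
    exact pos_of_mul_pos_right this (by positivity)
  · rw [energyDensity_eq_lagrangian hn hR.1 htr, trial_pow hn hw.le, hd', hde]

theorem IsTest.trial_mem (hn : 2 ≤ n) (H : IsTest n r v a b M m L)
    (hr : r ∈ admissible lam) (ht : IsSmall n r a M m t) :
    trial n r (prim v) t ∈ admissible lam := by
  refine ⟨H.trial_absolutelyContinuous hn hr ht, ?_,
    -- The positivity of the derivative involves neither κ nor h, so any values serve.
    (H.ae_trial (κ := 0) (h := 0) hn hr ht).mono fun R h => h.1, ?_⟩
  · have : prim v 1 = 0 := by simp [prim]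
    rw [trial, this, mul_zero, add_zero, hr.2.1]
    exact Real.pow_rpow_inv_natCast
      (hr.2.1 ▸ nonneg_of_admissible hr ⟨zero_le_one, le_rfl⟩) (by omega)
  · refine Real.rpow_nonneg (le_trans ?_ (H.half_pow_le hr ht ⟨le_rfl, zero_le_one⟩)) _
    have := hr.2.2.2
    positivity

end Test

/-! ### Integrability from finite energy -/

theorem IsCompressibilityTerm.differentiableAt (hh : IsCompressibilityTerm h) {d : ℝ}
    (hd : 0 < d) : DifferentiableAt ℝ h d :=
  (hh.contDiffOn.differentiableOn one_ne_zero).differentiableAt (Ioi_mem_nhds hd)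

theorem IsCompressibilityTerm.continuousAt_deriv (hh : IsCompressibilityTerm h) {d : ℝ}
    (hd : 0 < d) : ContinuousAt (deriv h) d :=
  (hh.contDiffOn.continuousOn_deriv_of_isOpen isOpen_Ioi le_rfl).continuousAt (Ioi_mem_nhds hd)

theorem integrableOn_mul_deriv (hr : r ∈ admissible lam) {g : ℝ → ℝ}
    (hg : ContinuousOn g (Icc 0 1)) : IntegrableOn (fun R => g R * deriv r R) (Ioo 0 1) := by
  have := hr.1.intervalIntegrable_deriv.continuousOn_mul
    (g := g) (by rwa [uIcc_of_le zero_le_one])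
  rw [intervalIntegrable_iff_integrableOn_Ioo_of_le zero_le_one] at this
  exact this

theorem integrableOn_p (hr : r ∈ admissible lam) :
    IntegrableOn (fun R => r R ^ (n - 1) * deriv r R) (Ioo 0 1) :=
  integrableOn_mul_deriv hr ((continuousOn_of_admissible hr).pow _)

/-- For n ≥ 2 the function xⁿ⁻¹ log x is continuous up to x = 0, so the factor of r' is continuous
on [0,1] even when r(0) = 0. -/
theorem integrableOn_p_mul_log (hn : 2 ≤ n) (hr : r ∈ admissible lam) :
    IntegrableOn (fun R => r R ^ (n - 1) * deriv r R * (1 / n + Real.log (r R))) (Ioo 0 1) := by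
  obtain ⟨m, rfl⟩ : ∃ m, n = m + 2 := ⟨n - 2, by omega⟩
  have hc := continuousOn_of_admissible hr
  have h1 : ContinuousOn (fun R => r R ^ (m + 1) * (1 / (m + 2 : ℕ)) +
      r R ^ m * (r R * Real.log (r R))) (Icc 0 1) :=
    ((hc.pow _).mul_const _).add ((hc.pow _).mul (Real.continuous_mul_log.comp_continuousOn hc))
  refine (integrableOn_mul_deriv hr h1).congr_fun (fun R _ => ?_) measurableSet_Ioo
  simp only [show m + 2 - 1 = m + 1 from rfl]
  ring

theorem mul_mem_admissible (hlam : 0 < lam) : (fun R => lam * R) ∈ admissible lam := by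
  refine ⟨?_, by simp, ?_, by simp⟩
  · exact (contDiff_const.mul contDiff_id).contDiffOn.absolutelyContinuousOnInterval
  · filter_upwards [ae_restrict_mem measurableSet_Ioo] with R hR
    rw [radialDeriv_eq_deriv hR]
    simpa using hlam

/-- The homogeneous deformation λR has finite energy, so a minimizer does too. -/
theorem integrableOn_energyDensity (hlam : 0 < lam)
    (hmin : ∀ s ∈ admissible lam, modifiedEnergy n κ h lam r ≤ modifiedEnergy n κ h lam s) :
    IntegrableOn (energyDensity n κ h r) (Ioo 0 1) := by
  by_contra hni
  have h1 := hmin _ (mul_mem_admissible hlam)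
  have h2 : IntegrableOn (energyDensity n κ h (fun R => lam * R)) (Ioo 0 1) := by
    have : IntegrableOn (fun R : ℝ => R ^ (n - 1) * (κ / n * lam ^ n + h (lam * lam ^ (n - 1))
        + κ * (n - 1) * (lam * lam ^ (n - 1)) * (1 / n + Real.log lam))) (Icc 0 1) :=
      (Continuous.continuousOn (by fun_prop)).integrableOn_Icc
    refine (this.mono_set Ioo_subset_Icc_self).congr_fun (fun R hR => ?_) measurableSet_Ioo
    have hd : radialDeriv (fun R => lam * R) R = lam := by
      rw [radialDeriv_eq_deriv hR]; simp
    have hR0 := hR.1.ne'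
    simp only [energyDensity, det, hd, mul_div_cancel_right₀ _ hR0]
  rw [modifiedEnergy, if_neg hni, modifiedEnergy, if_pos h2, top_le_iff] at h1
  exact EReal.coe_ne_top _ h1

theorem aemeasurable_r (hr : r ∈ admissible lam) :
    AEMeasurable r (volume.restrict (Ioo 0 1)) :=
  ((continuousOn_of_admissible hr).mono Ioo_subset_Icc_self).aemeasurable measurableSet_Ioo

/-- After removal of the integrable term with log r, the rest of the energy density is a sum of
nonnegative terms, because h ≥ 0 and log R ≤ 0 on (0,1). Each is then dominated by the sum. -/
theorem integrableOn_pow_mul_deriv_pow (hn : 2 ≤ n) (hκ : 0 < κ) (hh : IsCompressibilityTerm h)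
    (hr : r ∈ admissible lam) (hint : IntegrableOn (energyDensity n κ h r) (Ioo 0 1)) :
    IntegrableOn (fun R => R ^ (n - 1) * deriv r R ^ n) (Ioo 0 1) := by
  have hn0 : (0 : ℝ) < n := by positivity
  have hn1 : (0 : ℝ) ≤ n - 1 := by
    have : (2 : ℝ) ≤ n := by exact_mod_cast hn
    linarith
  have hg : IntegrableOn (fun R => n / κ * (energyDensity n κ h r R - κ * (n - 1) *
      (r R ^ (n - 1) * deriv r R * (1 / n + Real.log (r R))))) (Ioo 0 1) :=
    (hint.sub ((integrableOn_p_mul_log hn hr).const_mul _)).const_mul _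
  refine Integrable.mono' hg ?_ ?_
  · exact (((measurable_id.pow_const _).mul ((measurable_deriv r).pow_const _))).aestronglyMeasurable
  filter_upwards [ae_restrict_mem measurableSet_Ioo, ae_deriv_pos hr] with R hR hd
  have hR0 := hR.1
  have hrR := pos_of_admissible hr (R := R) ⟨hR.1, hR.2.le⟩
  have hdet : 0 < det n r R := by
    rw [det, radialDeriv_eq_deriv hR]; positivity
  have hdet' : R ^ (n - 1) * det n r R = r R ^ (n - 1) * deriv r R := by
    rw [det, radialDeriv_eq_deriv hR, div_pow]; field_simp
  rw [Real.norm_of_nonneg (by positivity), div_mul_eq_mul_div, le_div_iff₀ hκ, energyDensity,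
    ← hdet', Real.log_div hrR.ne' hR0.ne', radialDeriv_eq_deriv hR]
  have h1 := hh.nonneg _ hdet
  have h2 : Real.log R ≤ 0 := Real.log_nonpos hR0.le hR.2.le
  have h3 : 0 ≤ R ^ (n - 1) * h (det n r R) := by positivity
  have h4 : 0 ≤ κ * (n - 1) * (R ^ (n - 1) * det n r R) * (- Real.log R) := by
    have : 0 ≤ -Real.log R := by linarith
    positivity
  have h5 : n * (κ / n * (R ^ (n - 1) * deriv r R ^ n)) = R ^ (n - 1) * deriv r R ^ n * κ := by
    field_simp
  nlinarith [mul_nonneg hn0.le (add_nonneg h3 h4)]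

/-! ### Continuity and local bounds for the derivatives of the Lagrangian -/

theorem continuousAt_lagrangianP (hh : IsCompressibilityTerm h) {R w p : ℝ}
    (hR : 0 < R) (hw : 0 < w) (hp : 0 < p) :
    ContinuousAt (fun q : ℝ × ℝ × ℝ => lagrangianP n κ h q.1 q.2.1 q.2.2) (R, w, p) := by
  have hd : ContinuousAt (fun q : ℝ × ℝ × ℝ => q.2.2 / q.1 ^ (n - 1)) (R, w, p) :=
    ContinuousAt.div (by fun_prop) (by fun_prop) (by positivity)
  have hd' : ContinuousAt (fun q : ℝ × ℝ × ℝ => deriv h (q.2.2 / q.1 ^ (n - 1))) (R, w, p) :=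
    ContinuousAt.comp (g := deriv h) (hh.continuousAt_deriv (by positivity)) hd
  have hlw : ContinuousAt (fun q : ℝ × ℝ × ℝ => Real.log q.2.1) (R, w, p) :=
    ContinuousAt.log (by fun_prop) hw.ne'
  have hlR : ContinuousAt (fun q : ℝ × ℝ × ℝ => Real.log q.1) (R, w, p) :=
    ContinuousAt.log (by fun_prop) hR.ne'
  have hq : ContinuousAt (fun q : ℝ × ℝ × ℝ => q.2.2 ^ (n - 1) / q.2.1 ^ (n - 1)) (R, w, p) :=
    ContinuousAt.div (by fun_prop) (by fun_prop) (by positivity)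
  unfold lagrangianP
  exact ((ContinuousAt.mul (by fun_prop) hq).add hd').add
    (continuousAt_const.mul ((continuousAt_const.add (hlw.div_const _)).sub hlR))

theorem continuousAt_lagrangianW {R w p : ℝ} (hw : 0 < w) :
    ContinuousAt (fun q : ℝ × ℝ × ℝ => lagrangianW n κ q.1 q.2.1 q.2.2) (R, w, p) := by
  have hq : ContinuousAt (fun q : ℝ × ℝ × ℝ => q.2.2 ^ n / q.2.1 ^ n) (R, w, p) :=
    ContinuousAt.div (by fun_prop) (by fun_prop) (by positivity)
  have hq1 : ContinuousAt (fun q : ℝ × ℝ × ℝ => q.2.2 / q.2.1) (R, w, p) :=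
    ContinuousAt.div (by fun_prop) (by fun_prop) (by positivity)
  unfold lagrangianW
  exact continuousAt_const.mul (hq1.sub (ContinuousAt.mul (by fun_prop) hq))

theorem exists_bound_lagrangian (hh : IsCompressibilityTerm h) {b w₀ m : ℝ} (hb : 0 < b)
    (hw₀ : 0 < w₀) (hm : 0 < m) (w₁ L : ℝ) :
    ∃ B, ∀ R ∈ Icc b 1, ∀ w ∈ Icc w₀ w₁, ∀ p ∈ Icc m L,
      |lagrangianP n κ h R w p| ≤ B ∧ |lagrangianW n κ R w p| ≤ B := by
  have hK : IsCompact (Icc b 1 ×ˢ (Icc w₀ w₁ ×ˢ Icc m L)) :=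
    isCompact_Icc.prod (isCompact_Icc.prod isCompact_Icc)
  have h1 : ContinuousOn (fun q : ℝ × ℝ × ℝ => lagrangianP n κ h q.1 q.2.1 q.2.2)
      (Icc b 1 ×ˢ (Icc w₀ w₁ ×ˢ Icc m L)) := by
    rintro ⟨R, w, p⟩ ⟨hR, hw, hp⟩
    exact (continuousAt_lagrangianP hh (hb.trans_le hR.1) (hw₀.trans_le hw.1)
      (hm.trans_le hp.1)).continuousWithinAt
  have h2 : ContinuousOn (fun q : ℝ × ℝ × ℝ => lagrangianW n κ q.1 q.2.1 q.2.2)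
      (Icc b 1 ×ˢ (Icc w₀ w₁ ×ˢ Icc m L)) := by
    rintro ⟨R, w, p⟩ ⟨hR, hw, hp⟩
    exact (continuousAt_lagrangianW (hw₀.trans_le hw.1)).continuousWithinAt
  obtain ⟨B1, hB1⟩ := hK.exists_bound_of_continuousOn h1
  obtain ⟨B2, hB2⟩ := hK.exists_bound_of_continuousOn h2
  refine ⟨max B1 B2, fun R hR w hw p hp => ⟨?_, ?_⟩⟩
  · exact (hB1 (R, w, p) ⟨hR, hw, hp⟩).trans (le_max_left _ _)
  · exact (hB2 (R, w, p) ⟨hR, hw, hp⟩).trans (le_max_right _ _)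

/-- Nothing is known of h off (0,∞), so it is replaced by zero there. -/
theorem aemeasurable_comp_of_pos {μ : Measure ℝ} (hh : ContinuousOn h (Ioi 0)) {g : ℝ → ℝ}
    (hg : AEMeasurable g μ) (hpos : ∀ᵐ R ∂μ, 0 < g R) :
    AEMeasurable (fun R => h (g R)) μ := by
  classical
  have hm : Measurable ((Ioi (0 : ℝ)).piecewise h (fun _ => 0)) :=
    hh.measurable_piecewise continuousOn_const measurableSet_Ioi
  refine (hm.comp_aemeasurable hg).congr (hpos.mono fun R hR => ?_)
  simp only [Function.comp]
  exact piecewise_eq_of_mem _ _ _ hR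

/-! ### Measurability and domination along the variation -/

section Test

variable {v : ℝ → ℝ} {a b M m L t R : ℝ}

theorem IsTest.aemeasurable_w (H : IsTest n r v a b M m L) (hr : r ∈ admissible lam) (t : ℝ) :
    AEMeasurable (fun R => r R ^ n + n * t * prim v R) (volume.restrict (Ioo 0 1)) := by
  have h1 : ContinuousOn (prim v) (Icc 0 1) := by
    simpa [uIcc_of_le] using H.prim_absolutelyContinuous.continuousOn
  exact ((aemeasurable_r hr).pow_const _).add
    (((h1.mono Ioo_subset_Icc_self).aemeasurable measurableSet_Ioo).const_mul _)

theorem IsTest.aemeasurable_p (H : IsTest n r v a b M m L) (hr : r ∈ admissible lam) (t : ℝ) :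
    AEMeasurable (fun R => r R ^ (n - 1) * deriv r R + t * v R) (volume.restrict (Ioo 0 1)) :=
  (((aemeasurable_r hr).pow_const _).mul (measurable_deriv r).aemeasurable).add
    (H.aemeasurable.restrict.const_mul t)

theorem IsTest.aestronglyMeasurable_lagrangian (H : IsTest n r v a b M m L)
    (hh : IsCompressibilityTerm h) (hr : r ∈ admissible lam) (ht : IsSmall n r a M m t) :
    AEStronglyMeasurable (fun R => lagrangian n κ h R (r R ^ n + n * t * prim v R)
      (r R ^ (n - 1) * deriv r R + t * v R)) (volume.restrict (Ioo 0 1)) := by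
  have hw := H.aemeasurable_w hr t
  have hp := H.aemeasurable_p hr t
  have hR : AEMeasurable (fun R : ℝ => R) (volume.restrict (Ioo (0 : ℝ) 1)) := aemeasurable_id
  have hcomp := aemeasurable_comp_of_pos hh.contDiffOn.continuousOn (hp.div (hR.pow_const (n - 1)))
    (by
      filter_upwards [ae_restrict_mem measurableSet_Ioo, ae_deriv_pos hr] with R hR hd
      have h1 := H.pos_p hr ht hR hd
      have h2 := hR.1
      simp only [Pi.div_apply]
      positivity)
  refine AEMeasurable.aestronglyMeasurable ?_
  unfold lagrangian
  exact ((((hR.pow_const _).const_mul _).mul ((hp.pow_const _).div (hw.pow_const _))).add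
    ((hR.pow_const _).mul hcomp)).add ((hp.const_mul _).mul
    (((Real.measurable_log.comp_aemeasurable hw).div_const _).const_add _ |>.sub
      (Real.measurable_log.comp_aemeasurable hR)))

theorem IsTest.aestronglyMeasurable_lagrangian_deriv (H : IsTest n r v a b M m L)
    (hr : r ∈ admissible lam) (t : ℝ) :
    AEStronglyMeasurable (fun R => v R * lagrangianP n κ h R (r R ^ n + n * t * prim v R)
        (r R ^ (n - 1) * deriv r R + t * v R) +
      prim v R * lagrangianW n κ R (r R ^ n + n * t * prim v R)
        (r R ^ (n - 1) * deriv r R + t * v R)) (volume.restrict (Ioo 0 1)) := by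
  have hw := H.aemeasurable_w hr t
  have hp := H.aemeasurable_p hr t
  have hR : AEMeasurable (fun R : ℝ => R) (volume.restrict (Ioo (0 : ℝ) 1)) := aemeasurable_id
  have h1 : ContinuousOn (prim v) (Icc 0 1) := by
    simpa [uIcc_of_le] using H.prim_absolutelyContinuous.continuousOn
  have hψ := (h1.mono Ioo_subset_Icc_self).aemeasurable (μ := volume) measurableSet_Ioo
  refine AEMeasurable.aestronglyMeasurable ?_
  unfold lagrangianP lagrangianW
  refine (H.aemeasurable.restrict.mul ((((hR.pow_const _).const_mul _).mul
    ((hp.pow_const _).div (hw.pow_const _))).add ?_ |>.add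
    (((((Real.measurable_log.comp_aemeasurable hw).div_const _).const_add _).sub
      (Real.measurable_log.comp_aemeasurable hR)).const_mul _))).add
    (hψ.mul (((hp.div hw).sub ((hR.pow_const _).mul ((hp.pow_const _).div
      (hw.pow_const _)))).const_mul _))
  exact (measurable_deriv h).comp_aemeasurable (hp.div (hR.pow_const _))

/-- Where v ≠ 0, the triple (R,w,p) stays in a compact box for all small t, which gives the
constant. Where v = 0, p is not perturbed and only ψ·`lagrangianW` remains; it is free of h and is
dominated by p and Rⁿ⁻¹r'ⁿ. -/
theorem IsTest.exists_integrable_bound (H : IsTest n r v a b M m L) (hn : 2 ≤ n) (hκ : 0 < κ)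
    (hh : IsCompressibilityTerm h) (hr : r ∈ admissible lam)
    (hint : IntegrableOn (energyDensity n κ h r) (Ioo 0 1)) :
    ∃ g : ℝ → ℝ, IntegrableOn g (Ioo 0 1) ∧ ∀ᵐ R ∂(volume.restrict (Ioo (0 : ℝ) 1)),
      ∀ t, IsSmall n r a M m t →
      ‖v R * lagrangianP n κ h R (r R ^ n + n * t * prim v R)
        (r R ^ (n - 1) * deriv r R + t * v R) +
      prim v R * lagrangianW n κ R (r R ^ n + n * t * prim v R)
        (r R ^ (n - 1) * deriv r R + t * v R)‖ ≤ g R := by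
  have hn1 : (0 : ℝ) ≤ n - 1 := by
    have : (2 : ℝ) ≤ n := by exact_mod_cast hn
    linarith
  have hM := H.nonneg_M
  set w₀ := r a ^ n / 2 with hw₀
  have hw₀0 : 0 < w₀ := half_pos (pow_pos H.pos_a n)
  -- The margins w₀ and m/2 are the displacements of w and p that `IsSmall` permits.
  obtain ⟨B, hB⟩ := exists_bound_lagrangian (n := n) (κ := κ) hh (lt_min H.pos_b one_pos) hw₀0
    (half_pos H.pos_m) (lam ^ n + w₀) (L + m / 2)
  refine ⟨fun R => |2 * M * B| + M * (κ * (n - 1) * (w₀⁻¹ * (r R ^ (n - 1) * deriv r R) +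
    2 ^ (n - 1) * w₀⁻¹ * (R ^ (n - 1) * deriv r R ^ n))), ?_, ?_⟩
  · have hc : IntegrableOn (fun _ : ℝ => |2 * M * B|) (Ioo 0 1) :=
      integrableOn_const measure_Ioo_lt_top.ne
    exact hc.add (((((integrableOn_p hr).const_mul _).add
      ((integrableOn_pow_mul_deriv_pow hn hκ hh hr hint).const_mul _)).const_mul _).const_mul _)
  filter_upwards [ae_restrict_mem measurableSet_Ioo, ae_deriv_pos hr] with R hR hd t ht
  have hR' : R ∈ Icc (0 : ℝ) 1 := ⟨hR.1.le, hR.2.le⟩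
  have hR0 := hR.1
  have hrR := pos_of_admissible hr (R := R) ⟨hR.1, hR.2.le⟩
  set W := r R ^ n + n * t * prim v R with hW
  have hψ := H.abs_prim_le hR'
  have hg : 0 ≤ M * (κ * (n - 1) * (w₀⁻¹ * (r R ^ (n - 1) * deriv r R) +
    2 ^ (n - 1) * w₀⁻¹ * (R ^ (n - 1) * deriv r R ^ n))) := by positivity
  by_cases hv : v R = 0
  · rw [hv, zero_mul, zero_add, mul_zero, add_zero, norm_mul, Real.norm_eq_abs]
    by_cases hp0 : prim v R = 0
    · rw [hp0, abs_zero, zero_mul]; positivity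
    have hWa := H.half_pow_a_le hr ht hR' (H.le_of_prim_ne_zero hR' hp0)
    rw [← hW, ← hw₀] at hWa
    have hWr := H.half_pow_le hr ht hR'
    rw [← hW] at hWr
    have hW0 : 0 < W := hw₀0.trans_le hWa
    refine le_trans ?_ (le_add_of_nonneg_left (abs_nonneg _))
    refine mul_le_mul hψ ?_ (norm_nonneg _) hM
    rw [lagrangianW, norm_mul, Real.norm_of_nonneg (by positivity)]
    refine mul_le_mul_of_nonneg_left ?_ (by positivity)
    refine (norm_sub_le _ _).trans (add_le_add ?_ ?_)
    · rw [Real.norm_of_nonneg (by positivity), inv_mul_eq_div]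
      exact div_le_div_of_nonneg_left (by positivity) hw₀0 hWa
    · rw [Real.norm_of_nonneg (by positivity)]
      have e1 : (r R ^ (n - 1) * deriv r R) ^ n = (r R ^ n) ^ (n - 1) * deriv r R ^ n := by
        rw [mul_pow, ← pow_mul, ← pow_mul, mul_comm n]
      -- In Wⁿ, n − 1 factors are bounded below by rⁿ/2, to cancel the powers of r in pⁿ; the last
      -- factor is bounded below by the constant w₀.
      have e2 : (r R ^ n / 2) ^ (n - 1) * w₀ ≤ W ^ n := by
        calc (r R ^ n / 2) ^ (n - 1) * w₀ ≤ W ^ (n - 1) * W :=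
              mul_le_mul (pow_le_pow_left₀ (by positivity) hWr _) hWa hw₀0.le (by positivity)
          _ = W ^ n := by rw [← pow_succ, Nat.sub_add_cancel (by omega)]
      calc R ^ (n - 1) * ((r R ^ (n - 1) * deriv r R) ^ n / W ^ n)
          ≤ R ^ (n - 1) * ((r R ^ (n - 1) * deriv r R) ^ n / ((r R ^ n / 2) ^ (n - 1) * w₀)) := by
            gcongr
        _ = _ := by
            rw [e1, div_pow]
            field_simp
  · obtain ⟨-, haR, hbR, hmp, hpL⟩ := H.support R hv
    have hWa := H.half_pow_a_le hr ht hR' haR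
    have hWu : W ≤ lam ^ n + w₀ := by
      have h1 : r R ^ n ≤ lam ^ n := pow_le_pow_left₀ hrR.le
        (hr.2.1 ▸ (strictMonoOn_of_admissible hr).monotoneOn hR' ⟨zero_le_one, le_rfl⟩ hR.2.le) n
      have h2 : |n * t * prim v R| ≤ n * |t| * M := by
        rw [abs_mul, abs_mul, Nat.abs_cast]
        exact mul_le_mul_of_nonneg_left hψ (by positivity)
      linarith [le_abs_self (n * t * prim v R), ht.1]
    have hpl := H.half_m_le ht hv
    have hpu : r R ^ (n - 1) * deriv r R + t * v R ≤ L + m / 2 := by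
      have h2 : |t * v R| ≤ |t| * M := by
        rw [abs_mul]; exact mul_le_mul_of_nonneg_left (H.bound R) (abs_nonneg t)
      linarith [le_abs_self (t * v R), ht.2]
    obtain ⟨b1, b2⟩ := hB R ⟨(min_le_left _ _).trans hbR, hR.2.le⟩ W ⟨hWa, hWu⟩ _ ⟨hpl, hpu⟩
    refine le_trans ?_ (le_add_of_nonneg_right hg)
    refine (norm_add_le _ _).trans ?_
    rw [norm_mul, norm_mul]
    have c1 := mul_le_mul (H.bound R) b1 (abs_nonneg _) hM
    have c2 := mul_le_mul hψ b2 (abs_nonneg _) hM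
    simp only [Real.norm_eq_abs]
    linarith [le_abs_self (2 * M * B)]

end Test

/-! ### The first variation -/

theorem modifiedEnergy_eq_of_ae {f : ℝ → ℝ} (hint : IntegrableOn f (Ioo 0 1))
    (hf : energyDensity n κ h r =ᵐ[volume.restrict (Ioo 0 1)] f) :
    modifiedEnergy n κ h lam r =
      ((∫ R in Ioo (0 : ℝ) 1, f R) - κ * (n - 1) / n * lam ^ n * Real.log lam : ℝ) := by
  have h1 : IntegrableOn (energyDensity n κ h r) (Ioo 0 1) := Integrable.congr hint hf.symm
  rw [modifiedEnergy, if_pos h1, integral_congr_ae hf]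

section Test

variable {v : ℝ → ℝ} {a b M m L : ℝ}

theorem IsTest.first_variation (H : IsTest n r v a b M m L) (hn : 2 ≤ n) (hκ : 0 < κ)
    (hlam : 0 < lam) (hh : IsCompressibilityTerm h) (hr : r ∈ admissible lam)
    (hmin : ∀ s ∈ admissible lam, modifiedEnergy n κ h lam r ≤ modifiedEnergy n κ h lam s) :
    IntegrableOn (fun R => v R * lagrangianP n κ h R (r R ^ n) (r R ^ (n - 1) * deriv r R) +
      prim v R * lagrangianW n κ R (r R ^ n) (r R ^ (n - 1) * deriv r R)) (Ioo 0 1) ∧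
    ∫ R in Ioo (0 : ℝ) 1, (v R * lagrangianP n κ h R (r R ^ n) (r R ^ (n - 1) * deriv r R) +
      prim v R * lagrangianW n κ R (r R ^ n) (r R ^ (n - 1) * deriv r R)) = 0 := by
  have hint := integrableOn_energyDensity hlam hmin
  obtain ⟨ε, hε, hsmall⟩ := H.eventually_isSmall
  obtain ⟨g, hg, hbound⟩ := H.exists_integrable_bound hn hκ hh hr hint
  have hs : Ioo (-ε) ε ∈ 𝓝 (0 : ℝ) := Ioo_mem_nhds (by linarith) hε
  have h0 : (0 : ℝ) ∈ Ioo (-ε) ε := mem_of_mem_nhds hs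
  set F : ℝ → ℝ → ℝ := fun t R => lagrangian n κ h R (r R ^ n + n * t * prim v R)
      (r R ^ (n - 1) * deriv r R + t * v R) with hF
  set F' : ℝ → ℝ → ℝ := fun t R => v R * lagrangianP n κ h R (r R ^ n + n * t * prim v R)
        (r R ^ (n - 1) * deriv r R + t * v R) +
      prim v R * lagrangianW n κ R (r R ^ n + n * t * prim v R)
        (r R ^ (n - 1) * deriv r R + t * v R) with hF'
  have hdens : energyDensity n κ h r =ᵐ[volume.restrict (Ioo 0 1)] F 0 := by
    filter_upwards [ae_restrict_mem measurableSet_Ioo] with R hR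
    simp only [hF, mul_zero, zero_mul, add_zero]
    rw [energyDensity_eq_lagrangian hn hR.1 (pos_of_admissible hr ⟨hR.1, hR.2.le⟩),
      radialDeriv_eq_deriv hR]
  have hF0 : IntegrableOn (F 0) (Ioo 0 1) := Integrable.congr hint hdens
  have hbd : ∀ᵐ R ∂(volume.restrict (Ioo (0 : ℝ) 1)), ∀ t ∈ Ioo (-ε) ε, ‖F' t R‖ ≤ g R :=
    hbound.mono fun R hR t ht => hR t (hsmall t ht)
  have hder : ∀ᵐ R ∂(volume.restrict (Ioo (0 : ℝ) 1)), ∀ t ∈ Ioo (-ε) ε,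
      HasDerivAt (F · R) (F' t R) t := by
    filter_upwards [ae_restrict_mem measurableSet_Ioo, ae_deriv_pos hr] with R hR hd t ht
    exact hasDerivAt_lagrangian hn (fun d hd => hh.differentiableAt hd) hR.1
      (H.pos_w hr (hsmall t ht) ⟨hR.1, hR.2.le⟩) (H.pos_p hr (hsmall t ht) hR hd)
  have hmeas : ∀ t ∈ Ioo (-ε) ε, AEStronglyMeasurable (F t) (volume.restrict (Ioo 0 1)) :=
    fun t ht => H.aestronglyMeasurable_lagrangian hh hr (hsmall t ht)
  obtain ⟨hI', hD⟩ := hasDerivAt_integral_of_dominated_loc_of_deriv_le (F := F) (F' := F')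
    (μ := volume.restrict (Ioo (0 : ℝ) 1)) hs
    (eventually_of_mem hs hmeas) hF0 (H.aestronglyMeasurable_lagrangian_deriv hr 0) hbd hg hder
  -- The mean value inequality with the same dominating function shows that the trials have finite
  -- energy, so minimality compares real integrals.
  have hFint : ∀ t ∈ Ioo (-ε) ε, IntegrableOn (F t) (Ioo 0 1) := by
    intro t ht
    have hsub : IntegrableOn (fun R => F t R - F 0 R) (Ioo 0 1) := by
      refine Integrable.mono' (hg.mul_const |t|) ((hmeas t ht).sub (hmeas 0 h0)) ?_
      filter_upwards [hbd, hder] with R h1 h2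
      simpa using (convex_Ioo (-ε) ε).norm_image_sub_le_of_norm_hasDerivWithin_le
        (fun x hx => (h2 x hx).hasDerivWithinAt) h1 h0 ht
    refine (hsub.add hF0).congr_fun (fun R _ => ?_) measurableSet_Ioo
    simp
  have hlocmin : IsLocalMin (fun t => ∫ R in Ioo (0 : ℝ) 1, F t R) 0 := by
    filter_upwards [hs] with t ht
    have h1 := hmin _ (H.trial_mem hn hr (hsmall t ht))
    rw [modifiedEnergy_eq_of_ae hF0 hdens, modifiedEnergy_eq_of_ae (hFint t ht)
      ((H.ae_trial hn hr (hsmall t ht)).mono fun R hR => hR.2), EReal.coe_le_coe_iff] at h1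
    linarith
  have hz := hlocmin.hasDerivAt_eq_zero hD
  simp only [hF', mul_zero, zero_mul, add_zero] at hI' hz
  exact ⟨hI', hz⟩

end Test

/-! ### The stress, its rate, and integration by parts -/

/-- `r^(n-1) r'`. -/
noncomputable def momentum (n : ℕ) (r : ℝ → ℝ) (R : ℝ) : ℝ := r R ^ (n - 1) * deriv r R

/-- The modified radial Cauchy stress along `r`. -/
noncomputable def stress (n : ℕ) (κ : ℝ) (h r : ℝ → ℝ) (R : ℝ) : ℝ :=
  lagrangianP n κ h R (r R ^ n) (momentum n r R)

/-- The density whose primitive is, up to a constant, the modified radial Cauchy stress. -/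
noncomputable def stressRate (n : ℕ) (κ : ℝ) (r : ℝ → ℝ) (R : ℝ) : ℝ :=
  lagrangianW n κ R (r R ^ n) (momentum n r R)

theorem stressRate_eq (hn : 2 ≤ n) {R : ℝ} (hrR : 0 < r R) :
    stressRate n κ r R = κ * (n - 1) * ((r R)⁻¹ * deriv r R -
      (r R ^ n)⁻¹ * (R ^ (n - 1) * deriv r R ^ n)) := by
  obtain ⟨m, rfl⟩ : ∃ m, n = m + 2 := ⟨n - 2, by omega⟩
  simp only [stressRate, momentum, lagrangianW, show m + 2 - 1 = m + 1 from rfl]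
  have h1 : (r R ^ (m + 1) * deriv r R) ^ (m + 2) / (r R ^ (m + 2)) ^ (m + 2) =
      (r R ^ (m + 2))⁻¹ * deriv r R ^ (m + 2) := by
    rw [pow_succ (r R) (m + 1), mul_pow, mul_pow, inv_mul_eq_div]
    field_simp
    ring
  have h2 : r R ^ (m + 1) * deriv r R / r R ^ (m + 2) = (r R)⁻¹ * deriv r R := by
    rw [pow_succ (r R) (m + 1)]
    field_simp
  rw [h1, h2]
  ring

/-- On [a,1] the coefficients 1/r and 1/rⁿ are continuous. The case a = 0 is included when r(0) > 0,
and serves for the boundary condition at the origin. -/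
theorem intervalIntegrable_stressRate (hn : 2 ≤ n) (hr : r ∈ admissible lam)
    (hint : IntegrableOn (fun R => R ^ (n - 1) * deriv r R ^ n) (Ioo 0 1)) {a : ℝ} (ha : 0 ≤ a)
    (ha1 : a ≤ 1) (hra : 0 < r a) : IntervalIntegrable (stressRate n κ r) volume a 1 := by
  have hpos : ∀ R ∈ Icc a 1, 0 < r R := fun R hR => hra.trans_le
    ((strictMonoOn_of_admissible hr).monotoneOn ⟨ha, ha1⟩ ⟨ha.trans hR.1, hR.2⟩ hR.1)
  have hc : ContinuousOn r (uIcc a 1) := by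
    rw [uIcc_of_le ha1]
    exact (continuousOn_of_admissible hr).mono (Icc_subset_Icc_left ha)
  have hsub : uIcc a 1 ⊆ uIcc (0 : ℝ) 1 := by
    rw [uIcc_of_le ha1, uIcc_of_le zero_le_one]; exact Icc_subset_Icc_left ha
  have i1 : IntervalIntegrable (deriv r) volume a 1 := hr.1.intervalIntegrable_deriv.mono_set hsub
  have i2 : IntervalIntegrable (fun R => R ^ (n - 1) * deriv r R ^ n) volume a 1 := by
    refine IntervalIntegrable.mono_set (a := 0) (b := 1) ?_ hsub
    rwa [intervalIntegrable_iff_integrableOn_Ioo_of_le zero_le_one]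
  have i3 := ((i1.continuousOn_mul (hc.inv₀ fun R hR => (hpos R (by rwa [uIcc_of_le ha1] at hR)).ne')).sub
    (i2.continuousOn_mul ((hc.pow n).inv₀ fun R hR =>
      (pow_pos (hpos R (by rwa [uIcc_of_le ha1] at hR)) n).ne'))).const_mul (κ * (n - 1))
  refine i3.congr fun R hR => ?_
  rw [uIoc_of_le ha1] at hR
  exact (stressRate_eq hn (hpos R ⟨hR.1.le, hR.2⟩)).symm

theorem continuousOn_prim {f : ℝ → ℝ} {a : ℝ} (ha : a ≤ 1) (hf : IntervalIntegrable f volume a 1) :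
    ContinuousOn (prim f) (Icc a 1) := by
  have := (hf.absolutelyContinuousOnInterval_intervalIntegral (c := 1) (by simp)).continuousOn
  rwa [uIcc_of_le ha] at this

/-- The class of minimizers of the modified energy functional. -/
structure IsMinimizer (n : ℕ) (κ : ℝ) (h : ℝ → ℝ) (lam : ℝ) (r : ℝ → ℝ) : Prop where
  two_le : 2 ≤ n
  kappa_pos : 0 < κ
  lam_pos : 0 < lam
  compressibility : IsCompressibilityTerm h
  mem : r ∈ admissible lam
  le : ∀ s ∈ admissible lam, modifiedEnergy n κ h lam r ≤ modifiedEnergy n κ h lam s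

theorem IsMinimizer.intervalIntegrable (A : IsMinimizer n κ h lam r) {a : ℝ} (ha : 0 ≤ a)
    (ha1 : a ≤ 1) (hra : 0 < r a) : IntervalIntegrable (stressRate n κ r) volume a 1 :=
  intervalIntegrable_stressRate A.two_le A.mem (integrableOn_pow_mul_deriv_pow A.two_le A.kappa_pos
    A.compressibility A.mem (integrableOn_energyDensity A.lam_pos A.le)) ha ha1 hra

theorem IsMinimizer.continuousOn_prim_stressRate (A : IsMinimizer n κ h lam r) :
    ContinuousOn (prim (stressRate n κ r)) (Ioc 0 1) := by
  intro R hR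
  have hR2 : R / 2 ∈ Ioc (0 : ℝ) 1 := ⟨by linarith [hR.1], by linarith [hR.1, hR.2]⟩
  have := continuousOn_prim hR2.2 (A.intervalIntegrable hR2.1.le hR2.2 (pos_of_admissible A.mem hR2))
  refine (this R ⟨by linarith [hR.1], hR.2⟩).mono_of_mem_nhdsWithin ?_
  have : Ioi (R / 2) ∩ Ioc 0 1 ∈ 𝓝[Ioc 0 1] R :=
    inter_mem (mem_nhdsWithin_of_mem_nhds (Ioi_mem_nhds (by linarith [hR.1]))) self_mem_nhdsWithin
  exact mem_of_superset this fun x hx => ⟨(mem_Ioi.1 hx.1).le, hx.2.2⟩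

section Test

variable {v : ℝ → ℝ} {a b M m L : ℝ}

/-- Integrating ψQ by parts, with ψ(1) = 0, leaves a boundary term at a only. It is kept because it
carries the natural boundary condition when a = 0. -/
theorem IsTest.integral_mul_stress (H : IsTest n r v a b M m L) (A : IsMinimizer n κ h lam r) :
    ∫ R in a..1, v R * (stress n κ h r R - prim (stressRate n κ r) R) =
      prim v a * prim (stressRate n κ r) a := by
  have hr := A.mem
  have ha1 := H.lt_one.le
  obtain ⟨hI, hz⟩ := H.first_variation A.two_le A.kappa_pos A.lam_pos A.compressibility hr A.le
  change IntegrableOn (fun R => v R * stress n κ h r R + prim v R * stressRate n κ r R) _ at hI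
  change ∫ R in Ioo (0 : ℝ) 1, (v R * stress n κ h r R + prim v R * stressRate n κ r R) = 0 at hz
  set T := stress n κ h r
  set Q := stressRate n κ r with hQ
  have hQi : IntervalIntegrable Q volume a 1 := A.intervalIntegrable H.nonneg_a ha1 H.pos_a
  have hsub : uIcc a 1 ⊆ uIcc (0 : ℝ) 1 := by
    rw [uIcc_of_le ha1, uIcc_of_le zero_le_one]; exact Icc_subset_Icc_left H.nonneg_a
  have hψac := H.prim_absolutelyContinuous.mono hsub
  have hGac : AbsolutelyContinuousOnInterval (prim Q) a 1 :=
    hQi.absolutelyContinuousOnInterval_intervalIntegral (by simp)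
  have hψQ : IntervalIntegrable (fun R => prim v R * Q R) volume a 1 :=
    hQi.continuousOn_mul hψac.continuousOn
  have hvG : IntervalIntegrable (fun R => v R * prim Q R) volume a 1 :=
    (H.intervalIntegrable a 1).mul_continuousOn hGac.continuousOn
  have hIa : IntervalIntegrable (fun R => v R * T R + prim v R * Q R) volume a 1 := by
    refine IntervalIntegrable.mono_set (a := 0) (b := 1) ?_ hsub
    rwa [intervalIntegrable_iff_integrableOn_Ioo_of_le zero_le_one]
  have hvT : IntervalIntegrable (fun R => v R * T R) volume a 1 :=
    (hIa.sub hψQ).congr fun R _ => by ring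
  have hI0 : IntervalIntegrable (fun R => v R * T R + prim v R * Q R) volume 0 a := by
    refine IntervalIntegrable.mono_set (a := 0) (b := 1) ?_ ?_
    · rwa [intervalIntegrable_iff_integrableOn_Ioo_of_le zero_le_one]
    · rw [uIcc_of_le H.nonneg_a, uIcc_of_le zero_le_one]; exact Icc_subset_Icc_right ha1
  have hz' : ∫ R in a..1, (v R * T R + prim v R * Q R) = 0 := by
    rw [← integral_Ioc_eq_integral_Ioo, ← intervalIntegral.integral_of_le zero_le_one,
      ← intervalIntegral.integral_add_adjacent_intervals hI0 hIa] at hz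
    have h0 : ∫ R in (0 : ℝ)..a, (v R * T R + prim v R * Q R) = 0 := by
      rw [intervalIntegral.integral_of_le H.nonneg_a, integral_Ioc_eq_integral_Ioo]
      refine setIntegral_eq_zero_of_forall_eq_zero fun R hR => ?_
      have h1 : v R = 0 := by
        by_contra h0
        exact absurd (H.support R h0).2.1 (not_le.2 hR.2)
      have h2 : prim v R = 0 := H.prim_eq_zero ⟨hR.1.le, hR.2.le⟩ (hR.1.trans hR.2).ne'
      rw [h1, h2]; ring
    rwa [h0, zero_add] at hz
  have hparts := hψac.integral_mul_deriv_eq_deriv_mul hGac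
  have e1 : ∫ R in a..1, prim v R * deriv (prim Q) R = ∫ R in a..1, prim v R * Q R := by
    refine intervalIntegral.integral_congr_ae ?_
    filter_upwards [hQi.ae_hasDerivAt_integral] with R h1 h2
    congr 1
    exact (h1 (uIoc_subset_uIcc h2) 1 (by simp)).deriv
  have e2 : ∫ R in a..1, deriv (prim v) R * prim Q R = ∫ R in a..1, v R * prim Q R := by
    refine intervalIntegral.integral_congr_ae ?_
    filter_upwards [(H.intervalIntegrable a 1).ae_hasDerivAt_integral] with R h1 h2
    congr 1
    exact (h1 (uIoc_subset_uIcc h2) 1 (by simp)).deriv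
  have e3 : prim v 1 = 0 := by simp [prim]
  rw [e1, e2, e3] at hparts
  rw [intervalIntegral.integral_add hvT hψQ, hparts] at hz'
  simp only [mul_sub]
  rw [intervalIntegral.integral_sub hvT hvG]
  linarith

end Test

/-! ### The du Bois-Reymond argument on regular sets -/

/-- The points where `R` and `r^(n-1) r'` are bounded away from `0` and `∞`. -/
def regularSet (n : ℕ) (r : ℝ → ℝ) (k : ℕ) : Set ℝ :=
  {R ∈ Ioo (0 : ℝ) 1 | ((k : ℝ) + 2)⁻¹ < R ∧ ((k : ℝ) + 2)⁻¹ ≤ momentum n r R ∧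
    momentum n r R ≤ (k : ℝ) + 2}

theorem measurableSet_regularSet (hr : r ∈ admissible lam) (k : ℕ) :
    MeasurableSet (regularSet n r k) := by
  classical
  have h1 : Measurable ((Ioo (0 : ℝ) 1).piecewise r 0) :=
    ((continuousOn_of_admissible hr).mono Ioo_subset_Icc_self).measurable_piecewise
      continuousOn_const measurableSet_Ioo
  have h2 : Measurable (fun R => ((Ioo (0 : ℝ) 1).piecewise r 0) R ^ (n - 1) * deriv r R) :=
    (h1.pow_const _).mul (measurable_deriv r)
  have h3 : regularSet n r k = Ioo (0 : ℝ) 1 ∩ (Ioi ((k : ℝ) + 2)⁻¹ ∩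
      (fun R => ((Ioo (0 : ℝ) 1).piecewise r 0) R ^ (n - 1) * deriv r R) ⁻¹'
        Icc ((k : ℝ) + 2)⁻¹ ((k : ℝ) + 2)) := by
    ext R
    simp only [regularSet, mem_ofPred_eq, mem_inter_iff, mem_Ioi, mem_preimage, mem_Icc]
    refine and_congr_right fun hR => ?_
    rw [piecewise_eq_of_mem _ _ _ hR, momentum]
  rw [h3]
  exact measurableSet_Ioo.inter (measurableSet_Ioi.inter (h2 measurableSet_Icc))

theorem regularSet_mono : Monotone (regularSet n r) := by
  intro j k hjk R hR
  have h1 : (j : ℝ) + 2 ≤ k + 2 := by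
    have : (j : ℝ) ≤ k := by exact_mod_cast hjk
    linarith
  have h2 : ((k : ℝ) + 2)⁻¹ ≤ ((j : ℝ) + 2)⁻¹ := inv_anti₀ (by positivity) h1
  exact ⟨hR.1, h2.trans_lt hR.2.1, h2.trans hR.2.2.1, hR.2.2.2.trans h1⟩

theorem ae_exists_mem_regularSet (hr : r ∈ admissible lam) :
    ∀ᵐ R ∂(volume.restrict (Ioo (0 : ℝ) 1)), ∃ k, R ∈ regularSet n r k := by
  filter_upwards [ae_restrict_mem measurableSet_Ioo, ae_deriv_pos hr] with R hR hd
  have hp : 0 < momentum n r R := mul_pos (pow_pos (pos_of_admissible hr ⟨hR.1, hR.2.le⟩) _) hd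
  obtain ⟨k, hk⟩ := exists_nat_gt (max (R⁻¹) (max (momentum n r R)⁻¹ (momentum n r R)))
  simp only [max_lt_iff] at hk
  have hk0 : (0 : ℝ) < k := (inv_pos.2 hR.1).trans hk.1
  refine ⟨k, hR, ?_, ?_, by linarith [hk.2.2]⟩
  · exact inv_lt_of_inv_lt₀ hR.1 (by linarith [hk.1])
  · exact inv_le_of_inv_le₀ hp (by linarith [hk.2.1])

theorem IsMinimizer.exists_bound_stress (A : IsMinimizer n κ h lam r) (k : ℕ) :
    ∃ B, ∀ R ∈ regularSet n r k, |stress n κ h r R - prim (stressRate n κ r) R| ≤ B := by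
  have hb : (0 : ℝ) < ((k : ℝ) + 2)⁻¹ := by positivity
  have hb1 : ((k : ℝ) + 2)⁻¹ ≤ 1 := inv_le_one_of_one_le₀ (by linarith [k.cast_nonneg (α := ℝ)])
  have hmono := (strictMonoOn_of_admissible A.mem).monotoneOn
  have hrb := pos_of_admissible A.mem (R := ((k : ℝ) + 2)⁻¹) ⟨hb, hb1⟩
  obtain ⟨B, hB⟩ := exists_bound_lagrangian (n := n) (κ := κ) A.compressibility hb (pow_pos hrb n)
    hb (lam ^ n) ((k : ℝ) + 2)
  obtain ⟨B', hB'⟩ := isCompact_Icc.exists_bound_of_continuousOn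
    (continuousOn_prim hb1 (A.intervalIntegrable hb.le hb1 hrb))
  refine ⟨B + B', fun R hR => (abs_sub _ _).trans (add_le_add ?_ ?_)⟩
  · refine (hB R ⟨hR.2.1.le, hR.1.2.le⟩ (r R ^ n) ⟨?_, ?_⟩ _ ⟨hR.2.2.1, hR.2.2.2⟩).1
    · exact pow_le_pow_left₀ hrb.le
        (hmono ⟨hb.le, hb1⟩ ⟨hR.1.1.le, hR.1.2.le⟩ hR.2.1.le) n
    · rw [← A.mem.2.1]
      exact pow_le_pow_left₀ (pos_of_admissible A.mem ⟨hR.1.1, hR.1.2.le⟩).le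
        (hmono ⟨hR.1.1.le, hR.1.2.le⟩ ⟨zero_le_one, le_rfl⟩ hR.1.2.le) n
  · exact hB' R ⟨hR.2.1.le, hR.1.2.le⟩

theorem IsMinimizer.aemeasurable_stress (A : IsMinimizer n κ h lam r) :
    AEMeasurable (fun R => stress n κ h r R - prim (stressRate n κ r) R)
      (volume.restrict (Ioo 0 1)) := by
  have hw := (aemeasurable_r A.mem).pow_const n
  have hp := ((aemeasurable_r A.mem).pow_const (n - 1)).mul (measurable_deriv r).aemeasurable
  have hR : AEMeasurable (fun R : ℝ => R) (volume.restrict (Ioo (0 : ℝ) 1)) := aemeasurable_id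
  have hG := (A.continuousOn_prim_stressRate.mono Ioo_subset_Ioc_self).aemeasurable
    (μ := volume) measurableSet_Ioo
  refine AEMeasurable.sub ?_ hG
  unfold stress lagrangianP momentum
  refine (((hR.pow_const _).const_mul _).mul ((hp.pow_const _).div (hw.pow_const _))).add ?_ |>.add
    (((((Real.measurable_log.comp_aemeasurable hw).div_const _).const_add _).sub
      (Real.measurable_log.comp_aemeasurable hR)).const_mul _)
  exact (measurable_deriv h).comp_aemeasurable (hp.div (hR.pow_const _))

theorem regularSet_subset (k : ℕ) : regularSet n r k ⊆ Ioo (0 : ℝ) 1 := fun _ hR => hR.1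

theorem intervalIntegral_indicator_regularSet (hr : r ∈ admissible lam) (k : ℕ) {R : ℝ}
    (hR : R ≤ ((k : ℝ) + 2)⁻¹) (f : ℝ → ℝ) :
    ∫ x in R..1, (regularSet n r k).indicator f x = ∫ x in regularSet n r k, f x := by
  have hb1 : ((k : ℝ) + 2)⁻¹ ≤ 1 := inv_le_one_of_one_le₀ (by linarith [k.cast_nonneg (α := ℝ)])
  rw [intervalIntegral.integral_of_le (hR.trans hb1),
    setIntegral_indicator (measurableSet_regularSet hr k)]
  congr 2
  exact inter_eq_right.2 fun x hx => ⟨hR.trans_lt hx.2.1, hx.1.2.le⟩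

theorem IsMinimizer.isTest_indicator (A : IsMinimizer n κ h lam r) (k : ℕ) {f : ℝ → ℝ} {M a : ℝ}
    (hf : AEMeasurable f (volume.restrict (Ioo 0 1))) (hM0 : 0 ≤ M)
    (hM : ∀ R ∈ regularSet n r k, |f R| ≤ M) (ha : 0 ≤ a) (hak : a ≤ ((k : ℝ) + 2)⁻¹)
    (hra : 0 < r a) (hz : a = 0 ∨ ∫ R in regularSet n r k, f R = 0) :
    IsTest n r ((regularSet n r k).indicator f) a ((k : ℝ) + 2)⁻¹ M ((k : ℝ) + 2)⁻¹
      ((k : ℝ) + 2) where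
  aemeasurable := (aemeasurable_indicator_iff (measurableSet_regularSet A.mem k)).2
    (hf.mono_measure (Measure.restrict_mono (regularSet_subset k) le_rfl))
  bound R := by
    by_cases hR : R ∈ regularSet n r k
    · rw [indicator_of_mem hR]; exact hM R hR
    · rw [indicator_of_notMem hR, abs_zero]; exact hM0
  nonneg_a := ha
  lt_one := hak.trans_lt (inv_lt_one_of_one_lt₀ (by linarith [k.cast_nonneg (α := ℝ)]))
  pos_a := hra
  pos_b := by positivity
  pos_m := by positivity
  -- The set lies to the right of a, so on [0,a] the primitive is constantly minus the full
  -- integral.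
  primitive := hz.imp_right fun hz R hR => by
    rw [intervalIntegral.integral_symm,
      intervalIntegral_indicator_regularSet A.mem k (hR.2.trans hak), hz, neg_zero]
  support R hR := by
    have := mem_of_indicator_ne_zero hR
    exact ⟨this.1, hak.trans this.2.1.le, this.2.1.le, this.2.2.1, this.2.2.2⟩

theorem IsMinimizer.setIntegral_mul_stress (A : IsMinimizer n κ h lam r) (k : ℕ) {f : ℝ → ℝ}
    {M a : ℝ} (hf : AEMeasurable f (volume.restrict (Ioo 0 1))) (hM0 : 0 ≤ M)
    (hM : ∀ R ∈ regularSet n r k, |f R| ≤ M) (ha : 0 ≤ a) (hak : a ≤ ((k : ℝ) + 2)⁻¹)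
    (hra : 0 < r a) (hz : a = 0 ∨ ∫ R in regularSet n r k, f R = 0) :
    ∫ R in regularSet n r k, f R * (stress n κ h r R - prim (stressRate n κ r) R) =
      - (∫ R in regularSet n r k, f R) * prim (stressRate n κ r) a := by
  have H := A.isTest_indicator k hf hM0 hM ha hak hra hz
  have h1 := H.integral_mul_stress A
  rw [prim, intervalIntegral.integral_symm a 1,
    intervalIntegral_indicator_regularSet A.mem k hak] at h1
  rw [← h1, ← intervalIntegral_indicator_regularSet A.mem k hak]
  congr 1
  ext R
  exact indicator_mul_left _ _ _

/-- The test function is T − G minus its mean over the set. Mean zero makes its primitive vanish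
near the origin, so that a > 0 is allowed even if r(0) = 0, and it removes the boundary term. -/
theorem IsMinimizer.exists_ae_eq_const (A : IsMinimizer n κ h lam r) (k : ℕ) :
    ∃ c, ∀ᵐ R ∂(volume.restrict (regularSet n r k)),
      stress n κ h r R - prim (stressRate n κ r) R = c := by
  set S := regularSet n r k with hS
  set f := fun R => stress n κ h r R - prim (stressRate n κ r) R with hf
  have hb : (0 : ℝ) < ((k : ℝ) + 2)⁻¹ := by positivity
  have hb1 : ((k : ℝ) + 2)⁻¹ ≤ 1 := inv_le_one_of_one_le₀ (by linarith [k.cast_nonneg (α := ℝ)])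
  have hSfin : volume S ≠ ⊤ := ((measure_mono (regularSet_subset k)).trans_lt measure_Ioo_lt_top).ne
  by_cases hS0 : volume S = 0
  · exact ⟨0, by rw [Measure.restrict_eq_zero.2 hS0]; simp⟩
  have hSr : volume.real S ≠ 0 := (ENNReal.toReal_pos hS0 hSfin).ne'
  obtain ⟨B, hB⟩ := A.exists_bound_stress k
  have hSm := measurableSet_regularSet (n := n) A.mem k
  have hfm : AEMeasurable f (volume.restrict S) :=
    A.aemeasurable_stress.mono_measure (Measure.restrict_mono (regularSet_subset k) le_rfl)
  have hfi : IntegrableOn f S := by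
    refine Integrable.mono' (integrableOn_const hSfin (C := B)) hfm.aestronglyMeasurable ?_
    filter_upwards [ae_restrict_mem hSm] with R hR using hB R hR
  set c := (∫ R in S, f R) / volume.real S with hc
  refine ⟨c, ?_⟩
  have hci : IntegrableOn (fun _ => c) S := integrableOn_const hSfin
  have hmean : ∫ R in S, (f R - c) = 0 := by
    rw [integral_sub hfi hci, setIntegral_const, smul_eq_mul, hc]
    field_simp
    ring
  have hbound : ∀ R ∈ S, |f R - c| ≤ |B| + |c| := fun R hR =>
    (abs_sub _ _).trans (add_le_add ((hB R hR).trans (le_abs_self B)) le_rfl)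
  have h1 := A.setIntegral_mul_stress k (A.aemeasurable_stress.sub_const c)
    (by positivity : 0 ≤ |B| + |c|) hbound hb.le le_rfl (pos_of_admissible A.mem ⟨hb, hb1⟩)
    (Or.inr hmean)
  change ∫ R in S, (f R - c) * f R = - (∫ R in S, (f R - c)) * _ at h1
  rw [hmean, neg_zero, zero_mul] at h1
  have hfc : IntegrableOn (fun R => f R - c) S := hfi.sub hci
  have hfci : IntegrableOn (fun R => (f R - c) * f R) S := by
    refine Integrable.mono' (hfi.norm.const_mul (|B| + |c|))
      ((hfc.aestronglyMeasurable).mul hfi.aestronglyMeasurable) ?_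
    filter_upwards [ae_restrict_mem hSm] with R hR
    rw [norm_mul]
    exact mul_le_mul_of_nonneg_right (hbound R hR) (norm_nonneg _)
  have h2 : ∫ R in S, (f R - c) ^ 2 = 0 := by
    have : ∀ R, (f R - c) ^ 2 = (f R - c) * f R - (f R - c) * c := fun R => by ring
    simp only [this]
    rw [integral_sub hfci (hfc.mul_const c), h1, integral_mul_const, hmean]
    ring
  have hsq : IntegrableOn (fun R => (f R - c) ^ 2) S :=
    (hfci.sub (hfc.mul_const c)).congr (Eventually.of_forall fun R => by simp; ring)
  rw [setIntegral_eq_zero_iff_of_nonneg_ae (Eventually.of_forall fun R => sq_nonneg _) hsq] at h2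
  filter_upwards [h2] with R hR
  exact sub_eq_zero.1 (pow_eq_zero_iff two_ne_zero |>.1 hR)

/-- The regular sets are nested and one of them has positive measure, so the constants on larger
sets are determined by it. -/
theorem IsMinimizer.exists_stress_eq (A : IsMinimizer n κ h lam r) :
    ∃ c, (∀ᵐ R ∂(volume.restrict (Ioo (0 : ℝ) 1)),
      stress n κ h r R = prim (stressRate n κ r) R + c) ∧
      (0 < r 0 → c = - prim (stressRate n κ r) 0) := by
  choose c hc using A.exists_ae_eq_const
  have hae := ae_exists_mem_regularSet (n := n) A.mem
  obtain ⟨j, hj⟩ : ∃ j, volume (regularSet n r j) ≠ 0 := by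
    by_contra! hall
    have h0 : volume (⋃ k, regularSet n r k) = 0 := measure_iUnion_null hall
    rw [ae_iff, Measure.restrict_apply₀'  measurableSet_Ioo.nullMeasurableSet] at hae
    have h1 : volume (Ioo (0 : ℝ) 1) = 0 := by
      refine measure_mono_null ?_ (measure_union_null h0 hae)
      intro R hR
      by_cases hk : ∃ k, R ∈ regularSet n r k
      · exact Or.inl (mem_iUnion.2 hk)
      · exact Or.inr ⟨hk, hR⟩
    simp at h1
  have hNe : (ae (volume.restrict (regularSet n r j))).NeBot :=
    ae_neBot.2 (mt Measure.restrict_eq_zero.1 hj)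
  have hconst : ∀ k, ∀ᵐ R ∂(volume.restrict (regularSet n r k)),
      stress n κ h r R - prim (stressRate n κ r) R = c j := by
    intro k
    have h1 := ae_mono (Measure.restrict_mono (regularSet_mono (le_max_left j k)) le_rfl)
      (hc (max j k))
    obtain ⟨R, hR1, hR2⟩ := ((hc j).and h1).exists
    filter_upwards [ae_mono (Measure.restrict_mono (regularSet_mono (le_max_right j k)) le_rfl)
      (hc (max j k))] with R hR
    rw [hR, ← hR2, hR1]
  refine ⟨c j, ?_, fun hr0 => ?_⟩
  · have hall := ae_all_iff.2 fun k =>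
      (ae_restrict_iff' (measurableSet_regularSet (n := n) A.mem k)).1 (hconst k)
    filter_upwards [hae, ae_restrict_of_ae hall] with R hk hR
    obtain ⟨k, hk⟩ := hk
    linarith [hR k hk]
  -- With a = 0 no mean condition is imposed: the indicator of the set is a test function, and its
  -- primitive at 0 is minus the measure of the set.
  · have h1 := A.setIntegral_mul_stress j (f := fun _ => 1) (M := 1) aemeasurable_const zero_le_one
      (by simp) le_rfl (by positivity) hr0 (Or.inl rfl)
    have h2 : ∫ R in regularSet n r j, 1 * (stress n κ h r R - prim (stressRate n κ r) R) =
        ∫ R in regularSet n r j, c j :=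
      integral_congr_ae ((hconst j).mono fun R hR => by simpa using hR)
    rw [h2, setIntegral_const, setIntegral_const, smul_eq_mul, smul_eq_mul, mul_one] at h1
    have hpos : volume.real (regularSet n r j) ≠ 0 := (ENNReal.toReal_pos hj
      ((measure_mono (regularSet_subset j)).trans_lt measure_Ioo_lt_top).ne).ne'
    have h3 : volume.real (regularSet n r j) * c j =
        volume.real (regularSet n r j) * (- prim (stressRate n κ r) 0) := by linarith
    exact mul_left_cancel₀ hpos h3

/-! ### From the integrated equation to C¹ regularity -/

theorem hasDerivWithinAt_of_eq_prim {f F : ℝ → ℝ} {C : ℝ} (hf : ContinuousOn f (Ioc 0 1))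
    (hF : ∀ R ∈ Ioc (0 : ℝ) 1, F R = C + prim f R) {R : ℝ} (hR : R ∈ Ioc (0 : ℝ) 1) :
    HasDerivWithinAt F (f R) (Ioc 0 1) R := by
  -- A constant extension past 1 makes the two-sided fundamental theorem apply at R = 1 as well.
  set g := fun x => f (min x 1) with hg
  have hgc : ContinuousOn g (Ioi 0) := hf.comp (by fun_prop) fun x hx =>
    ⟨lt_min hx one_pos, min_le_right _ _⟩
  have hgi : IntervalIntegrable g volume 1 R :=
    (hgc.mono fun x hx => (lt_min one_pos hR.1).trans_le hx.1).intervalIntegrable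
  have h1 : HasDerivAt (prim g) (g R) R := intervalIntegral.integral_hasDerivAt_right hgi
    (hgc.stronglyMeasurableAtFilter isOpen_Ioi R hR.1) (hgc.continuousAt (Ioi_mem_nhds hR.1))
  have h2 : g R = f R := by simp [hg, min_eq_left hR.2]
  rw [h2] at h1
  refine (h1.const_add C).hasDerivWithinAt.congr (fun x hx => ?_) ?_
  all_goals
    first
    | rw [hF x hx]
    | rw [hF R hR]
    congr 1
    refine intervalIntegral.integral_congr fun y hy => ?_
    have : y ≤ 1 := hy.2.trans (max_le le_rfl (by first | exact hx.2 | exact hR.2))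
    simp [hg, min_eq_left this]

theorem hasDerivWithinAt_Icc_of_Ioc {F : ℝ → ℝ} {d R : ℝ} (hR : R ∈ Ioc (0 : ℝ) 1)
    (hF : HasDerivWithinAt F d (Ioc 0 1) R) : HasDerivWithinAt F d (Icc 0 1) R := by
  refine hF.mono_of_mem_nhdsWithin ?_
  have : Ioi 0 ∩ Icc (0 : ℝ) 1 ∈ 𝓝[Icc 0 1] R :=
    inter_mem (mem_nhdsWithin_of_mem_nhds (Ioi_mem_nhds hR.1)) self_mem_nhdsWithin
  exact mem_of_superset this fun x hx => ⟨hx.1, hx.2.2⟩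

theorem contDiffOn_one_of_hasDerivWithinAt {F f : ℝ → ℝ} (hf : ContinuousOn f (Ioc 0 1))
    (hF : ∀ R ∈ Ioc (0 : ℝ) 1, HasDerivWithinAt F (f R) (Ioc 0 1) R) :
    ContDiffOn ℝ 1 F (Ioc 0 1) := by
  have hu : UniqueDiffOn ℝ (Ioc (0 : ℝ) 1) := uniqueDiffOn_Ioc 0 1
  rw [contDiffOn_one_iff_derivWithin hu]
  refine ⟨fun R hR => (hF R hR).differentiableWithinAt, hf.congr fun R hR => ?_⟩
  exact (hF R hR).derivWithin (hu R hR)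

theorem IsCompressibilityTerm.strictMonoOn_deriv (hh : IsCompressibilityTerm h) :
    StrictMonoOn (deriv h) (Ioi 0) := by
  refine strictMonoOn_of_deriv_pos (convex_Ioi 0)
    (fun d hd => (hh.continuousAt_deriv hd).continuousWithinAt) fun d hd => ?_
  rw [interior_Ioi] at hd
  exact hh.second_deriv_pos d hd

theorem lagrangianP_strictMonoOn (hκ : 0 < κ) (hh : IsCompressibilityTerm h) {R w : ℝ}
    (hR : 0 < R) (hw : 0 < w) : StrictMonoOn (lagrangianP n κ h R w) (Ioi 0) := by
  intro p hp q hq hpq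
  have hp0 : 0 < p := hp
  have hq0 : 0 < q := hq
  have h1 : deriv h (p / R ^ (n - 1)) < deriv h (q / R ^ (n - 1)) :=
    hh.strictMonoOn_deriv (mem_Ioi.2 (by positivity)) (mem_Ioi.2 (by positivity))
      (div_lt_div_of_pos_right hpq (by positivity))
  have h2 : κ * R ^ (n - 1) * (p ^ (n - 1) / w ^ (n - 1)) ≤
      κ * R ^ (n - 1) * (q ^ (n - 1) / w ^ (n - 1)) := by gcongr
  unfold lagrangianP
  linarith

theorem exists_lagrangianP_eq (hκ : 0 < κ) (hh : IsCompressibilityTerm h) {R w : ℝ}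
    (hR : 0 < R) (hw : 0 < w) (X : ℝ) : ∃ p, 0 < p ∧ lagrangianP n κ h R w p = X := by
  have hRn : 0 < R ^ (n - 1) := pow_pos hR _
  set C := κ * (n - 1) * (1 / n + Real.log w / n - Real.log R) with hC
  have hcont : ContinuousOn (lagrangianP n κ h R w) (Ioi 0) := fun p hp =>
    ((continuousAt_lagrangianP hh hR hw hp).comp (f := fun p => (R, w, p))
      (by fun_prop)).continuousWithinAt
  have htop : ∃ p, 0 < p ∧ X ≤ lagrangianP n κ h R w p := by
    obtain ⟨d, hd0, hd⟩ := ((eventually_gt_atTop (0 : ℝ)).and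
      (hh.deriv_tendsto_top.eventually_ge_atTop (X - C))).exists
    refine ⟨d * R ^ (n - 1), by positivity, ?_⟩
    have : 0 ≤ κ * R ^ (n - 1) * ((d * R ^ (n - 1)) ^ (n - 1) / w ^ (n - 1)) := by positivity
    rw [lagrangianP, mul_div_cancel_right₀ _ hRn.ne']
    linarith
  have hbot : ∃ p, 0 < p ∧ lagrangianP n κ h R w p ≤ X := by
    -- For d ≤ R^(1-n) one has p = dRⁿ⁻¹ ≤ 1, so the power term is at most D while h'(d) falls to
    -- −∞.
    set D := κ * R ^ (n - 1) * (1 / w ^ (n - 1)) with hD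
    have hmem : Ioc (0 : ℝ) (R ^ (n - 1))⁻¹ ∈ 𝓝[>] (0 : ℝ) := Ioc_mem_nhdsGT (by positivity)
    obtain ⟨d, hd0, hd⟩ := ((eventually_of_mem hmem fun x hx => hx).and
      (hh.deriv_tendsto_zero.eventually_le_atBot (X - C - D))).exists
    have hdp : 0 < d := hd0.1
    refine ⟨d * R ^ (n - 1), by positivity, ?_⟩
    have h1 : d * R ^ (n - 1) ≤ 1 := by
      calc d * R ^ (n - 1) ≤ (R ^ (n - 1))⁻¹ * R ^ (n - 1) := by
            exact mul_le_mul_of_nonneg_right hd0.2 hRn.le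
        _ = 1 := inv_mul_cancel₀ hRn.ne'
    have h2 : (d * R ^ (n - 1)) ^ (n - 1) ≤ 1 := pow_le_one₀ (by positivity) h1
    have : κ * R ^ (n - 1) * ((d * R ^ (n - 1)) ^ (n - 1) / w ^ (n - 1)) ≤ D := by
      rw [hD]; gcongr
    rw [lagrangianP, mul_div_cancel_right₀ _ hRn.ne']
    linarith
  obtain ⟨p1, hp1, h1⟩ := hbot
  obtain ⟨p2, hp2, h2⟩ := htop
  obtain ⟨p, hp, hpe⟩ := isPreconnected_Ioi.intermediate_value (mem_Ioi.2 hp1) (mem_Ioi.2 hp2)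
    hcont ⟨h1, h2⟩
  exact ⟨p, hp, hpe⟩

/-- By strict monotonicity in p, comparing p(R) with a fixed q amounts to comparing H(R) with the
Lagrangian derivative at q, an open condition in R. This needs no continuity of h''. -/
theorem continuousOn_of_lagrangianP_eq (hκ : 0 < κ) (hh : IsCompressibilityTerm h) {s : Set ℝ}
    {w p H : ℝ → ℝ} (hs : ∀ R ∈ s, 0 < R) (hw : ContinuousOn w s) (hw0 : ∀ R ∈ s, 0 < w R)
    (hp0 : ∀ R ∈ s, 0 < p R) (hH : ContinuousOn H s)
    (heq : ∀ R ∈ s, lagrangianP n κ h R (w R) (p R) = H R) : ContinuousOn p s := by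
  intro R₀ hR₀
  have hfix : ∀ q, 0 < q → ContinuousWithinAt (fun R => lagrangianP n κ h R (w R) q) s R₀ := by
    intro q hq
    exact (continuousAt_lagrangianP hh (hs R₀ hR₀) (hw0 R₀ hR₀) hq).comp_continuousWithinAt
      (f := fun R => (R, w R, q))
      (continuousWithinAt_id.prodMk ((hw R₀ hR₀).prodMk continuousWithinAt_const))
  have hmono : ∀ R ∈ s, StrictMonoOn (lagrangianP n κ h R (w R)) (Ioi 0) := fun R hR =>
    lagrangianP_strictMonoOn hκ hh (hs R hR) (hw0 R hR)
  refine tendsto_order.2 ⟨fun q hq => ?_, fun q hq => ?_⟩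
  · rcases le_or_gt q 0 with hq0 | hq0
    · filter_upwards [self_mem_nhdsWithin] with R hR using hq0.trans_lt (hp0 R hR)
    have h1 : lagrangianP n κ h R₀ (w R₀) q < H R₀ := by
      rw [← heq R₀ hR₀]; exact hmono R₀ hR₀ hq0 (hp0 R₀ hR₀) hq
    filter_upwards [self_mem_nhdsWithin, (hfix q hq0).eventually_lt (hH R₀ hR₀) h1] with R hR h2
    rw [← heq R hR] at h2
    exact ((hmono R hR).lt_iff_lt hq0 (hp0 R hR)).1 h2
  · have hq0 : 0 < q := (hp0 R₀ hR₀).trans hq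
    have h1 : H R₀ < lagrangianP n κ h R₀ (w R₀) q := by
      rw [← heq R₀ hR₀]; exact hmono R₀ hR₀ (hp0 R₀ hR₀) hq0 hq
    filter_upwards [self_mem_nhdsWithin, (hH R₀ hR₀).eventually_lt (hfix q hq0) h1] with R hR h2
    rw [← heq R hR] at h2
    exact ((hmono R hR).lt_iff_lt (hp0 R hR) hq0).1 h2

/-- Solving the stress equation for p at every R gives a continuous function. Injectivity identifies
it a.e. with rⁿ⁻¹r', so r is the primitive of a continuous function. -/
theorem IsMinimizer.regularity (A : IsMinimizer n κ h lam r) :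
    ContinuousOn (radialDeriv r) (Ioc 0 1) ∧
    (∀ R ∈ Ioc (0 : ℝ) 1, 0 < radialDeriv r R ∧
      HasDerivWithinAt r (radialDeriv r R) (Ioc 0 1) R) ∧
    ∃ c, (0 < r 0 → c = - prim (stressRate n κ r) 0) ∧ ∀ R ∈ Ioc (0 : ℝ) 1,
      lagrangianP n κ h R (r R ^ n) (r R ^ (n - 1) * radialDeriv r R) =
        c + prim (stressRate n κ r) R := by
  obtain ⟨c, hc, hc0⟩ := A.exists_stress_eq
  have hr := A.mem
  have hcont : ContinuousOn r (Ioc 0 1) := (continuousOn_of_admissible hr).mono Ioc_subset_Icc_self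
  have hpos : ∀ R ∈ Ioc (0 : ℝ) 1, 0 < r R := fun R hR => pos_of_admissible hr hR
  have hex : ∀ R : ℝ, ∃ p, R ∈ Ioc (0 : ℝ) 1 → 0 < p ∧
      lagrangianP n κ h R (r R ^ n) p = c + prim (stressRate n κ r) R := by
    intro R
    by_cases hR : R ∈ Ioc (0 : ℝ) 1
    · obtain ⟨p, hp⟩ := exists_lagrangianP_eq (n := n) A.kappa_pos A.compressibility hR.1
        (pow_pos (hpos R hR) n) (c + prim (stressRate n κ r) R)
      exact ⟨p, fun _ => hp⟩
    · exact ⟨0, fun h => absurd h hR⟩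
  choose p hp using hex
  have hpc : ContinuousOn p (Ioc 0 1) := continuousOn_of_lagrangianP_eq A.kappa_pos
    A.compressibility (fun R hR => hR.1) (hcont.pow n) (fun R hR => pow_pos (hpos R hR) n)
    (fun R hR => (hp R hR).1) (continuousOn_const.add A.continuousOn_prim_stressRate)
    (fun R hR => (hp R hR).2)
  set d := fun R => p R / r R ^ (n - 1) with hd
  have hdc : ContinuousOn d (Ioc 0 1) :=
    hpc.div (hcont.pow _) fun R hR => (pow_pos (hpos R hR) _).ne'
  have hae : ∀ᵐ R ∂(volume.restrict (Ioo (0 : ℝ) 1)), deriv r R = d R := by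
    filter_upwards [hc, ae_restrict_mem measurableSet_Ioo, ae_deriv_pos hr] with R h1 hR h2
    have hR' : R ∈ Ioc (0 : ℝ) 1 := ⟨hR.1, hR.2.le⟩
    have h3 := (lagrangianP_strictMonoOn (n := n) A.kappa_pos A.compressibility hR.1
      (pow_pos (hpos R hR') n)).injOn (mul_pos (pow_pos (hpos R hR') (n - 1)) h2) (hp R hR').1
      (h1.trans ((add_comm _ _).trans (hp R hR').2.symm))
    rw [hd, eq_div_iff (pow_pos (hpos R hR') _).ne', mul_comm]
    exact h3
  have hrep : ∀ R ∈ Ioc (0 : ℝ) 1, r R = lam + prim d R := by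
    intro R hR
    have hac : AbsolutelyContinuousOnInterval r R 1 := hr.1.mono (by
      rw [uIcc_of_le hR.2, uIcc_of_le zero_le_one]; exact Icc_subset_Icc_left hR.1.le)
    have h1 := hac.integral_deriv_eq_sub
    have h2 : ∫ x in R..1, deriv r x = ∫ x in R..1, d x := by
      rw [intervalIntegral.integral_of_le hR.2, intervalIntegral.integral_of_le hR.2,
        integral_Ioc_eq_integral_Ioo, integral_Ioc_eq_integral_Ioo]
      exact integral_congr_ae
        (ae_mono (Measure.restrict_mono (Ioo_subset_Ioo_left hR.1.le) le_rfl) hae)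
    rw [prim, intervalIntegral.integral_symm R 1, ← h2, h1, hr.2.1]
    ring
  have hder : ∀ R ∈ Ioc (0 : ℝ) 1, HasDerivWithinAt r (d R) (Ioc 0 1) R := fun R hR =>
    hasDerivWithinAt_of_eq_prim hdc hrep hR
  have hrd : ∀ R ∈ Ioc (0 : ℝ) 1, radialDeriv r R = d R := fun R hR =>
    (hasDerivWithinAt_Icc_of_Ioc hR (hder R hR)).derivWithin
      (uniqueDiffOn_Icc zero_lt_one R ⟨hR.1.le, hR.2⟩)
  refine ⟨hdc.congr hrd, fun R hR => ⟨?_, ?_⟩, c, hc0, fun R hR => ?_⟩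
  · rw [hrd R hR]; exact div_pos (hp R hR).1 (pow_pos (hpos R hR) _)
  · rw [hrd R hR]; exact hder R hR
  · rw [hrd R hR, hd, mul_div_cancel₀ _ (pow_pos (hpos R hR) _).ne']
    exact (hp R hR).2

/-- Once r' is continuous, so is Q, and the integrated equation may be differentiated at every
point. -/
theorem IsMinimizer.hasDerivWithinAt_stress (A : IsMinimizer n κ h lam r) {R : ℝ}
    (hR : R ∈ Ioc (0 : ℝ) 1) :
    HasDerivWithinAt
      (fun R => lagrangianP n κ h R (r R ^ n) (r R ^ (n - 1) * radialDeriv r R))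
      (lagrangianW n κ R (r R ^ n) (r R ^ (n - 1) * radialDeriv r R)) (Ioc 0 1) R := by
  obtain ⟨hc, -, c, -, heq⟩ := A.regularity
  have hcont : ContinuousOn r (Ioc 0 1) :=
    (continuousOn_of_admissible A.mem).mono Ioc_subset_Icc_self
  have hWc : ContinuousOn
      (fun R => lagrangianW n κ R (r R ^ n) (r R ^ (n - 1) * radialDeriv r R)) (Ioc 0 1) := by
    intro R hR
    exact (continuousAt_lagrangianW (pow_pos (pos_of_admissible A.mem hR) n)).comp_continuousWithinAt
      (f := fun R => (R, r R ^ n, r R ^ (n - 1) * radialDeriv r R))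
      (continuousWithinAt_id.prodMk (((hcont R hR).pow n).prodMk
        (((hcont R hR).pow _).mul (hc R hR))))
  refine hasDerivWithinAt_of_eq_prim hWc (C := c) (fun R hR => ?_) hR
  rw [heq R hR, prim, prim, intervalIntegral.integral_symm R 1, intervalIntegral.integral_symm R 1,
    intervalIntegral.integral_of_le hR.2, intervalIntegral.integral_of_le hR.2,
    integral_Ioc_eq_integral_Ioo, integral_Ioc_eq_integral_Ioo]
  congr 2
  refine setIntegral_congr_fun measurableSet_Ioo fun x hx => ?_
  simp only [stressRate, momentum, radialDeriv_eq_deriv ⟨hR.1.trans hx.1, hx.2⟩]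

/-! ### The partial derivatives of Φ̂ in terms of the Lagrangian -/

theorem add_smul_single {n : ℕ} (v : Fin n → ℝ) (i : Fin n) (t : ℝ) :
    v + t • Pi.single i (1 : ℝ) = Function.update v i (v i + t) := by
  ext j
  by_cases hj : j = i
  · subst hj; simp
  · simp [hj]

theorem prod_stretches_erase [NeZero n] (R : ℝ) :
    ∏ i ∈ Finset.univ.erase (0 : Fin n), stretches n r R i = (r R / R) ^ (n - 1) := by
  rw [Finset.prod_congr rfl (g := fun _ => r R / R)]
  · simp [div_pow]
  · intro i hi
    simp [stretches, Function.update_of_ne (Finset.ne_of_mem_erase hi)]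

theorem hatPhiPartial_zero [NeZero n] (hn : 2 ≤ n) (hh : IsCompressibilityTerm h) {R : ℝ}
    (hR : 0 < R) (hrR : 0 < r R) (hd : 0 < radialDeriv r R) :
    hatPhiPartial n κ h 0 r R = (r R / R) ^ (n - 1) *
      lagrangianP n κ h R (r R ^ n) (r R ^ (n - 1) * radialDeriv r R) := by
  have hn0 : (n : ℝ) ≠ 0 := by positivity
  set y := r R / R with hy
  set q := radialDeriv r R with hq
  have hy0 : 0 < y := by positivity
  set P := y ^ (n - 1) with hP
  have hP0 : 0 < P := by positivity
  have hline : ∀ t, hatPhi n κ h (stretches n r R + t • Pi.single 0 1) =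
      κ / n * (q + t) ^ n + h ((q + t) * P) +
        κ * ((q + t) * P) * ((n - 1) / n + Real.log P) := by
    intro t
    have h0 : stretches n r R 0 = q := by simp [stretches, hq]
    have he : ∏ i ∈ Finset.univ.erase (0 : Fin n),
        Function.update (stretches n r R) 0 (q + t) i = P := by
      rw [hP, hy, ← prod_stretches_erase]
      exact Finset.prod_congr rfl fun i hi => Function.update_of_ne (Finset.ne_of_mem_erase hi) _ _
    rw [add_smul_single, h0, hatPhi, he,
      ← Finset.mul_prod_erase Finset.univ _ (Finset.mem_univ (0 : Fin n)), he]
    simp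
  have hqt : HasDerivAt (fun t : ℝ => q + t) 1 0 := (hasDerivAt_id 0).const_add q
  have hH : HasDerivAt (fun t => h ((q + t) * P)) (deriv h (q * P) * (1 * P)) 0 := by
    have h1 : HasDerivAt h (deriv h (q * P)) ((q + 0) * P) := by
      rw [add_zero]; exact (hh.differentiableAt (by positivity)).hasDerivAt
    exact h1.comp (0 : ℝ) (hqt.mul_const P)
  have hD := (((hqt.pow n).const_mul (κ / n)).add hH).add
    (((hqt.mul_const P).const_mul κ).mul_const ((n - 1) / n + Real.log P))
  have hD' : HasLineDerivAt ℝ (hatPhi n κ h) _ (stretches n r R) (Pi.single 0 1) :=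
    hD.congr_of_eventuallyEq (Eventually.of_forall hline)
  have e1 : r R ^ (n - 1) * q / R ^ (n - 1) = q * P := by
    rw [hP, hy, div_pow]; ring
  have e2 : Real.log (r R ^ n) / n - Real.log R = Real.log y := by
    rw [hy, Real.log_div hrR.ne' hR.ne', Real.log_pow]; field_simp
  have e3 : P * (R ^ (n - 1) * ((r R ^ (n - 1) * q) ^ (n - 1) / (r R ^ n) ^ (n - 1))) =
      q ^ (n - 1) := by
    have : (r R ^ n) ^ (n - 1) = r R ^ (n - 1) * (r R ^ (n - 1)) ^ (n - 1) := by
      rw [← mul_pow, ← pow_succ', Nat.sub_add_cancel (by omega)]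
    rw [this, hP, hy, mul_pow, div_pow]
    field_simp
  have e4 : Real.log P = (n - 1) * Real.log y := by
    rw [hP, Real.log_pow, Nat.cast_sub (by omega), Nat.cast_one]
  rw [hatPhiPartial, hD'.lineDeriv, lagrangianP, e1, add_sub_assoc, e2, e4]
  simp only [add_zero]
  have e5 : κ / n * (n * q ^ (n - 1) * 1) = κ * q ^ (n - 1) := by field_simp
  rw [e5, ← e3]
  ring

/-- This is the chain rule in r for Rⁿ⁻¹Φ̂ = L(R, rⁿ, rⁿ⁻¹r'): the n − 1 equal stretches r/R supply
the left side, the two arguments depending on r the right. -/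
theorem hatPhiPartial_one [NeZero n] (hn : 2 ≤ n) (hh : IsCompressibilityTerm h) {R : ℝ}
    (hR : 0 < R) (hrR : 0 < r R) (hd : 0 < radialDeriv r R) :
    (n - 1) * R ^ (n - 2) * hatPhiPartial n κ h 1 r R =
      (n - 1) * r R ^ (n - 2) * radialDeriv r R *
        lagrangianP n κ h R (r R ^ n) (r R ^ (n - 1) * radialDeriv r R) +
      r R ^ (n - 1) * lagrangianW n κ R (r R ^ n) (r R ^ (n - 1) * radialDeriv r R) := by
  obtain ⟨m, rfl⟩ : ∃ m, n = m + 2 := ⟨n - 2, by omega⟩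
  set y := r R / R with hy
  set q := radialDeriv r R with hq
  have hy0 : 0 < y := by positivity
  have h10 : (1 : Fin (m + 2)) ≠ 0 := by simp
  have hline : ∀ t, hatPhi (m + 2) κ h (stretches (m + 2) r R + t • Pi.single 1 1) =
      κ / (m + 2 : ℕ) * q ^ (m + 2) + h (q * ((y + t) * y ^ m)) +
        κ * (q * ((y + t) * y ^ m)) *
          (((m + 2 : ℕ) - 1) / (m + 2 : ℕ) + Real.log ((y + t) * y ^ m)) := by
    intro t
    have h0 : stretches (m + 2) r R 0 = q := by simp [stretches, hq]
    have h1 : stretches (m + 2) r R 1 = y := by simp [stretches, hy]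
    have he : ∏ i ∈ Finset.univ.erase (0 : Fin (m + 2)),
        Function.update (stretches (m + 2) r R) 1 (y + t) i = (y + t) * y ^ m := by
      rw [← Finset.mul_prod_erase _ _ (Finset.mem_erase.2 ⟨h10, Finset.mem_univ _⟩)]
      rw [Function.update_self]
      congr 1
      rw [Finset.prod_congr rfl (g := fun _ => y)]
      · simp [Finset.card_erase_of_mem, h10]
      · intro i hi
        simp only [Finset.mem_erase] at hi
        rw [Function.update_of_ne hi.1, stretches, Function.update_of_ne hi.2.1]
    have h00 : Function.update (stretches (m + 2) r R) 1 (y + t) 0 = q := by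
      rw [Function.update_of_ne h10.symm, h0]
    rw [add_smul_single, h1, hatPhi, he,
      ← Finset.mul_prod_erase Finset.univ _ (Finset.mem_univ (0 : Fin (m + 2))), he, h00]
  have hyt : HasDerivAt (fun t : ℝ => (y + t) * y ^ m) (1 * y ^ m) 0 :=
    ((hasDerivAt_id 0).const_add y).mul_const _
  have hH : HasDerivAt (fun t => h (q * ((y + t) * y ^ m)))
      (deriv h (q * (y * y ^ m)) * (q * (1 * y ^ m))) 0 := by
    have h1 : HasDerivAt h (deriv h (q * (y * y ^ m))) (q * ((y + 0) * y ^ m)) := by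
      rw [add_zero]; exact (hh.differentiableAt (by positivity)).hasDerivAt
    exact h1.comp (0 : ℝ) (hyt.const_mul q)
  have hl := (hyt.log (by rw [add_zero]; positivity)).const_add
    ((((m + 2 : ℕ) : ℝ) - 1) / (m + 2 : ℕ))
  have hD := (hH.const_add (κ / (m + 2 : ℕ) * q ^ (m + 2))).add
    (((hyt.const_mul q).const_mul κ).mul hl)
  have hD' : HasLineDerivAt ℝ (hatPhi (m + 2) κ h) _ (stretches (m + 2) r R) (Pi.single 1 1) :=
    hD.congr_of_eventuallyEq (Eventually.of_forall hline)
  have e1 : r R ^ (m + 1) * q / R ^ (m + 1) = q * (y * y ^ m) := by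
    rw [hy, ← pow_succ', div_pow]; ring
  have e2 : Real.log (r R ^ (m + 2)) / (m + 2 : ℕ) - Real.log R = Real.log y := by
    rw [hy, Real.log_div hrR.ne' hR.ne', Real.log_pow]; field_simp
  have e4 : Real.log (y * y ^ m) = (m + 1) * Real.log y := by
    rw [← pow_succ', Real.log_pow]; push_cast; ring
  have hrr : r R = y * R := by rw [hy]; field_simp
  rw [hatPhiPartial, hD'.lineDeriv, lagrangianP, lagrangianW]
  simp only [show m + 2 - 1 = m + 1 from rfl, show m + 2 - 2 = m from rfl, add_zero]
  rw [e1, add_sub_assoc, e2, e4, hrr]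
  generalize deriv h (q * (y * y ^ m)) = D
  generalize Real.log y = l
  have w1 : ((y * R) ^ (m + 1) * q) ^ (m + 1) / ((y * R) ^ (m + 2)) ^ (m + 1) =
      q ^ (m + 1) / (y * R) ^ (m + 1) := by
    rw [pow_succ (y * R) (m + 1), mul_pow, mul_pow]; field_simp; ring
  have w2 : ((y * R) ^ (m + 1) * q) ^ (m + 2) / ((y * R) ^ (m + 2)) ^ (m + 2) =
      q ^ (m + 2) / (y * R) ^ (m + 2) := by
    rw [pow_succ (y * R) (m + 1), mul_pow, mul_pow]; field_simp; ring
  rw [w1, w2]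
  push_cast
  simp only [mul_pow, pow_succ]
  field_simp
  ring

end Cavitation

/- The variations perturb `rⁿ` rather than `r`. In terms of `rⁿ` the determinant depends on the
derivative alone, so it changes only where the derivative is perturbed, and there everything is
bounded. This is why the growth condition on `h'` is not used. -/
theorem mainTheorem2 (n : ℕ) [NeZero n] (hn : 2 ≤ n) (κ : ℝ) (hκ : 0 < κ) (lam : ℝ)
    (hlam : 0 < lam) (h : ℝ → ℝ) (hh : Cavitation.IsCompressibilityTerm h)
    (hgrowth : Cavitation.DerivGrowth h) (r : ℝ → ℝ) (hr : r ∈ Cavitation.admissible lam)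
    (hmin : ∀ s ∈ Cavitation.admissible lam,
      Cavitation.modifiedEnergy n κ h lam r ≤ Cavitation.modifiedEnergy n κ h lam s) :
    ContDiffOn ℝ 1 r (Ioc 0 1) ∧
    (∀ R ∈ Ioc (0 : ℝ) 1, 0 < Cavitation.radialDeriv r R) ∧
    ContDiffOn ℝ 1 (fun R => R ^ (n - 1) * Cavitation.hatPhiPartial n κ h 0 r R) (Ioc 0 1) ∧
    (∀ R ∈ Ioc (0 : ℝ) 1,
      HasDerivWithinAt (fun R => R ^ (n - 1) * Cavitation.hatPhiPartial n κ h 0 r R)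
        ((n - 1) * R ^ (n - 2) * Cavitation.hatPhiPartial n κ h 1 r R) (Ioc 0 1) R) ∧
    (0 < r 0 → Tendsto (Cavitation.modifiedStress n κ h r) (𝓝[>] 0) (𝓝 0)) := by
  open Cavitation in
  have A : IsMinimizer n κ h lam r := ⟨hn, hκ, hlam, hh, hr, hmin⟩
  obtain ⟨hc, hder, c, hc0, heq⟩ := A.regularity
  have hpos : ∀ R ∈ Ioc (0 : ℝ) 1, 0 < r R := fun R hR => pos_of_admissible hr hR
  have hrc : ContinuousOn r (Ioc 0 1) := (continuousOn_of_admissible hr).mono Ioc_subset_Icc_self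
  have hPhi : ∀ R ∈ Ioc (0 : ℝ) 1, R ^ (n - 1) * hatPhiPartial n κ h 0 r R = r R ^ (n - 1) *
      lagrangianP n κ h R (r R ^ n) (r R ^ (n - 1) * radialDeriv r R) := by
    intro R hR
    have hR0 := hR.1
    rw [hatPhiPartial_zero hn hh hR.1 (hpos R hR) (hder R hR).1, div_pow]
    field_simp
  have hEL : ∀ R ∈ Ioc (0 : ℝ) 1,
      HasDerivWithinAt (fun R => R ^ (n - 1) * hatPhiPartial n κ h 0 r R)
        ((n - 1) * R ^ (n - 2) * hatPhiPartial n κ h 1 r R) (Ioc 0 1) R := by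
    intro R hR
    refine HasDerivWithinAt.congr ?_ hPhi (hPhi R hR)
    -- The product rule for rⁿ⁻¹T gives exactly the right side of `hatPhiPartial_one`.
    have h1 := ((hder R hR).2.pow (n - 1)).mul (A.hasDerivWithinAt_stress hR)
    refine h1.congr_deriv ?_
    rw [hatPhiPartial_one hn hh hR.1 (hpos R hR) (hder R hR).1, Nat.cast_sub (by omega),
      Nat.cast_one, show n - 1 - 1 = n - 2 by omega]
    rfl
  refine ⟨contDiffOn_one_of_hasDerivWithinAt hc fun R hR => (hder R hR).2,
    fun R hR => (hder R hR).1, contDiffOn_one_of_hasDerivWithinAt ?_ hEL, hEL, fun hr0 => ?_⟩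
  · have hx : ∀ R ∈ Ioc (0 : ℝ) 1, ContinuousWithinAt (fun R => (R, r R ^ n,
        r R ^ (n - 1) * radialDeriv r R)) (Ioc 0 1) R := fun R hR =>
      continuousWithinAt_id.prodMk (((hrc R hR).pow n).prodMk (((hrc R hR).pow _).mul (hc R hR)))
    have hP : ContinuousOn (fun R => lagrangianP n κ h R (r R ^ n)
        (r R ^ (n - 1) * radialDeriv r R)) (Ioc 0 1) := fun R hR =>
      (A.hasDerivWithinAt_stress hR).continuousWithinAt
    have hW : ContinuousOn (fun R => lagrangianW n κ R (r R ^ n)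
        (r R ^ (n - 1) * radialDeriv r R)) (Ioc 0 1) := fun R hR =>
      (continuousAt_lagrangianW (pow_pos (hpos R hR) n)).comp_continuousWithinAt
        (f := fun R => (R, r R ^ n, r R ^ (n - 1) * radialDeriv r R)) (hx R hR)
    refine ContinuousOn.congr ?_ fun R hR =>
      hatPhiPartial_one hn hh hR.1 (hpos R hR) (hder R hR).1
    exact (((continuousOn_const.mul (hrc.pow _)).mul hc).mul hP).add ((hrc.pow _).mul hW)
  -- Since r(0) > 0, Q is integrable up to the origin and G is continuous there; the value of c
  -- makes the limit zero.
  · have hG := continuousOn_prim zero_le_one (A.intervalIntegrable le_rfl zero_le_one hr0)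
    have hlim : Tendsto (fun R => c + prim (stressRate n κ r) R) (𝓝[>] 0) (𝓝 0) := by
      have h1 : ContinuousWithinAt (prim (stressRate n κ r)) (Ioi 0) 0 :=
        (hG 0 ⟨le_rfl, zero_le_one⟩).mono_of_mem_nhdsWithin
          (mem_of_superset (Ioc_mem_nhdsGT zero_lt_one) Ioc_subset_Icc_self)
      have h2 := h1.tendsto.const_add c
      rw [hc0 hr0] at h2 ⊢
      rwa [neg_add_cancel] at h2
    refine hlim.congr' ?_
    filter_upwards [Ioc_mem_nhdsGT (zero_lt_one (α := ℝ))] with R hR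
    have hy : 0 < (r R / R) ^ (n - 1) := pow_pos (div_pos (hpos R hR) hR.1) _
    rw [modifiedStress, hatPhiPartial_zero hn hh hR.1 (hpos R hR) (hder R hR).1,
      mul_div_cancel_left₀ _ hy.ne', heq R hR]
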